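/- Let $n\in\mathbb N$, $T>0$ and $\alpha\in(0,1)$. Let $\|\cdot\|$ and $\langle\cdot,\cdot\rangle$ be the Euclidean norm and inner product of $\mathbb R^n$. **Definitions.** For $\beta>0$ put $(I^\beta\psi)(\tau)=\frac1{\Gamma(\beta)}\int_0^\tau\frac{\psi(\xi)}{(\tau-\xi)^{1-\beta}}\,d\xi$, and put $I^0\psi=\psi$. Let $AC^\alpha([0,T],\mathbb R^n)$ be the set of functions $x:[0,T]\to\mathbb R^n$ of the form $x(\tau)=x(0)+(I^\alpha\psi)(\tau)$, $\tau\in[0,T]$, with $\psi\in L^\infty([0,T],\mathbb R^n)$; such functions are continuous. For such $x$, the Caputo derivative is $({}^CD^\alpha x)(\tau)=\frac{d}{d\tau}\big(I^{1-\alpha}(x(\cdot)-x(0))\big)(\tau)$, which exists for a.e. $\tau\in[0,T]$. Let $G_n$ be the set of pairs $(t,w)$ with $t\in[0,T]$ and $w\in C([0,t],\mathbb R^n)$, endowed with the metric $$\mathrm{dist}\big((t,w),(t',w')\big)=\max\big\{d^*\big((t,w),(t',w')\big),\,d^*\big((t',w'),(t,w)\big)\big\},$$ $$d^*\big((t,w),(t',w')\big)=\max_{\tau\in[0,t]}\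 \min_{\tau'\in[0,t']}\sqrt{|\tau-\tau'|^2+\|w(\tau)-w'(\tau')\|^2}.$$ For $x\in C([0,T],\mathbb R^n)$ and $t\in[0,T]$, let $x_t$ be the restriction of $x$ to $[0,t]$. Let $\|x\|_{[0,T]}=\max_{\tau\in[0,T]}\|x(\tau)\|$ be the norm of $C([0,T],\mathbb R^n)$. For $\beta\in[0,1-\alpha)$ and $\mu>0$, put, for $(t,w)\in G_n$, $$V^*_{\beta,\mu}(t,w)=\frac1{\Gamma(1-\alpha-\beta)}\int_0^t\frac{e^{-\mu(t-\tau)^{\alpha+\beta}}}{(t-\tau)^{\alpha+\beta}}\,\big(I^\beta\|w(\cdot)-w(0)\|^2\big)(\tau)\,d\tau .$$ **Statement.** For every $\lambda>0$ there exist a number $\lambda_*>0$ and a functional $V_*:G_n\to\mathbb R$ such that: 1. $V_*$ is nonnegative and continuous. In addition, $V_*(t,w)=0$ whenever $(t,w)\in G_n$ and $w(\tau)=w(0)$ for all $\tau\in[0,t]$. 2. For every $x\in AC^\alpha([0,T],\mathbb R^n)$, the function $v_*(t)=V_*(t,x_t)$, $t\in[0,T]$, is Lipschitz continuous and, for a.e.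 $t\in[0,T]$, $$\dot v_*(t)\le e^{-\lambda_*t}\big(2\langle x(t)-x(0),({}^CD^\alpha x)(t)\rangle-\lambda\|x(t)-x(0)\|^2\big).$$ 3. For every compact set $X\subset C([0,T],\mathbb R^n)$ and every $\rho>0$ there exists $\delta>0$ such that, for every $x\in X$, the inequality $V_*(T,x)\le\delta$ implies $\|x(\cdot)-x(0)\|_{[0,T]}\le\rho$. 4. $V_*$ has the following form. If $m\ge1$ is the integer with $2^{-m}\le\alpha<2^{-(m-1)}$ and $\beta_i=(2^{i-1}-1)\alpha$ for $i=1,\dots,m$ (so that $0\le\beta_i<1-\alpha$), then there are numbers $\mu_1,\dots,\mu_m>0$ with $$V_*(t,w)=\frac{e^{-\lambda_*t}}m\sum_{i=1}^mV^*_{\beta_i,\mu_i}(t,w),\qquad (t,w)\in G_n.$$ -/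

import Mathlib

noncomputable section

namespace FracHJ

/-- The Euclidean space `ℝⁿ`. -/
abbrev E (n : ℕ) : Type := EuclideanSpace ℝ (Fin n)

/-- The point `0` of the interval `[0, t]`. -/
def zeroPt {t : ℝ} (ht : 0 ≤ t) : Set.Icc (0 : ℝ) t := ⟨0, le_rfl, ht⟩

/-- The set `G_n` of pairs `(t, w)` with `t ∈ [0, T]` and `w : [0, t] → ℝⁿ` continuous. -/
structure G (n : ℕ) (T : ℝ) where
  time : Set.Icc (0 : ℝ) T
  path : C(Set.Icc (0 : ℝ) (time : ℝ), E n)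

namespace G

variable {n : ℕ} {T : ℝ}

lemma time_nonneg (p : G n T) : 0 ≤ (p.time : ℝ) := p.time.2.1

/-- The initial value `w(0)`. -/
def init (p : G n T) : E n := p.path (zeroPt p.time_nonneg)

/-- The path `w`, extended from `[0, t]` to `ℝ` by constants
(only the values on `[0, t]` are ever used). -/
def ext (p : G n T) : ℝ → E n := Set.IccExtend p.time_nonneg p.path

/-- Euclidean distance in `ℝ × ℝⁿ` between the points `(τ, w(τ))` and `(τ', w'(τ'))`. -/
def ptDist (p q : G n T) (τ : Set.Icc (0 : ℝ) (p.time : ℝ))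
    (τ' : Set.Icc (0 : ℝ) (q.time : ℝ)) : ℝ :=
  Real.sqrt (|(τ : ℝ) - (τ' : ℝ)| ^ 2 + ‖p.path τ - q.path τ'‖ ^ 2)

/-- One-sided distance: the maximum over `τ ∈ [0, t]` of the minimum over `τ' ∈ [0, t']`. -/
def distStar (p q : G n T) : ℝ :=
  ⨆ τ : Set.Icc (0 : ℝ) (p.time : ℝ), ⨅ τ' : Set.Icc (0 : ℝ) (q.time : ℝ), ptDist p q τ τ'

instance : Dist (G n T) := ⟨fun p q => max (distStar p q) (distStar q p)⟩

instance nonempty_Icc (p : G n T) : Nonempty (Set.Icc (0 : ℝ) (p.time : ℝ)) :=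
  ⟨zeroPt p.time_nonneg⟩

lemma ptDist_nonneg (p q : G n T) (τ : Set.Icc (0 : ℝ) (p.time : ℝ))
    (τ' : Set.Icc (0 : ℝ) (q.time : ℝ)) : 0 ≤ ptDist p q τ τ' := Real.sqrt_nonneg _

lemma ptDist_eq (p q : G n T) (τ : Set.Icc (0 : ℝ) (p.time : ℝ))
    (τ' : Set.Icc (0 : ℝ) (q.time : ℝ)) :
    ptDist p q τ τ' = dist (WithLp.toLp 2 ((τ : ℝ), p.path τ)) (WithLp.toLp 2 ((τ' : ℝ), q.path τ')) := by
  rw [WithLp.prod_dist_eq_of_L2]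
  simp [ptDist, dist_eq_norm]

lemma continuous_ptDist (p q : G n T) :
    Continuous fun z : Set.Icc (0 : ℝ) (p.time : ℝ) × Set.Icc (0 : ℝ) (q.time : ℝ) =>
      ptDist p q z.1 z.2 := by
  unfold ptDist
  fun_prop

lemma distStar_le_iff (p q : G n T) (c : ℝ) :
    distStar p q ≤ c ↔ ∀ τ, ∃ τ', ptDist p q τ τ' ≤ c := by
  have hb : ∀ τ, BddBelow (Set.range fun τ' => ptDist p q τ τ') := fun τ =>
    ⟨0, by rintro _ ⟨τ', rfl⟩; exact ptDist_nonneg _ _ _ _⟩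
  have ha : BddAbove (Set.range fun τ => ⨅ τ', ptDist p q τ τ') := by
    obtain ⟨C, hC⟩ := (isCompact_range (continuous_ptDist p q)).bddAbove
    refine ⟨C, ?_⟩
    rintro _ ⟨τ, rfl⟩
    exact (ciInf_le (hb τ) (zeroPt q.time_nonneg)).trans
      (hC ⟨(τ, zeroPt q.time_nonneg), rfl⟩)
  constructor
  · intro h τ
    have hc : Continuous fun τ' => ptDist p q τ τ' :=
      (continuous_ptDist p q).comp (by fun_prop : Continuous fun τ' => (τ, τ'))
    obtain ⟨τ', -, hτ'⟩ := isCompact_univ.exists_isMinOn Set.univ_nonempty hc.continuousOn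
    refine ⟨τ', le_trans ?_ ((le_ciSup ha τ).trans h)⟩
    exact le_ciInf fun s => hτ' (Set.mem_univ s)
  · intro h
    refine ciSup_le fun τ => ?_
    obtain ⟨τ', hτ'⟩ := h τ
    exact (ciInf_le (hb τ) τ').trans hτ'

lemma dist_le_iff (p q : G n T) (c : ℝ) :
    dist p q ≤ c ↔ (∀ τ, ∃ τ', ptDist p q τ τ' ≤ c) ∧ ∀ τ, ∃ τ', ptDist q p τ τ' ≤ c := by
  rw [← distStar_le_iff, ← distStar_le_iff]
  exact max_le_iff

lemma distStar_triangle (p q r : G n T) : distStar p r ≤ distStar p q + distStar q r := by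
  rw [distStar_le_iff]
  intro τ
  obtain ⟨s, hs⟩ := (distStar_le_iff p q _).1 le_rfl τ
  obtain ⟨u, hu⟩ := (distStar_le_iff q r _).1 le_rfl s
  refine ⟨u, le_trans ?_ (add_le_add hs hu)⟩
  simp only [ptDist_eq]
  exact dist_triangle _ _ _

lemma exists_eq_of_distStar_le (p q : G n T) (h : distStar p q ≤ 0)
    (τ : Set.Icc (0 : ℝ) (p.time : ℝ)) :
    ∃ τ' : Set.Icc (0 : ℝ) (q.time : ℝ), (τ : ℝ) = τ' ∧ p.path τ = q.path τ' := by
  obtain ⟨s, hs⟩ := (distStar_le_iff p q _).1 h τ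
  rw [ptDist_eq] at hs
  have h1 := congrArg WithLp.ofLp (dist_le_zero.1 hs)
  exact ⟨s, congrArg Prod.fst h1, congrArg Prod.snd h1⟩

/-- `G_n` with the Hausdorff-type distance `dist` above is a metric space. -/
instance : MetricSpace (G n T) where
  dist_self p := by
    refine le_antisymm ?_ ?_
    · rw [dist_le_iff]
      exact ⟨fun τ => ⟨τ, by simp [ptDist]⟩, fun τ => ⟨τ, by simp [ptDist]⟩⟩
    · obtain ⟨s, hs⟩ := (distStar_le_iff p p _).1 le_rfl (zeroPt p.time_nonneg)
      exact ((ptDist_nonneg _ _ _ _).trans hs).trans (le_max_left _ _)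
  dist_comm p q := max_comm _ _
  dist_triangle p q r := by
    refine max_le ?_ ?_
    · exact (distStar_triangle p q r).trans
        (add_le_add (le_max_left _ _) (le_max_left _ _))
    · refine (distStar_triangle r q p).trans ?_
      rw [add_comm]
      exact add_le_add (le_max_right _ _) (le_max_right _ _)
  eq_of_dist_eq_zero := by
    intro p q h
    have h1 : distStar p q ≤ 0 := (le_max_left _ _).trans h.le
    have h2 : distStar q p ≤ 0 := (le_max_right _ _).trans h.le
    have e1 := exists_eq_of_distStar_le p q h1
    have e2 := exists_eq_of_distStar_le q p h2
    obtain ⟨t, w⟩ := p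
    obtain ⟨t', w'⟩ := q
    have ht : t = t' := by
      apply Subtype.ext
      obtain ⟨s, hs, -⟩ := e1 ⟨t, t.2.1, le_rfl⟩
      obtain ⟨s', hs', -⟩ := e2 ⟨t', t'.2.1, le_rfl⟩
      exact le_antisymm (hs.le.trans s.2.2) (hs'.le.trans s'.2.2)
    subst ht
    congr 1
    ext1 τ
    obtain ⟨s, hs, hw⟩ := e1 τ
    have : τ = s := Subtype.ext hs
    subst this
    exact hw

end G

/-- The restriction `x_t` of `x ∈ C([0, T], ℝⁿ)` to `[0, t]`, as the element `(t, x_t)` of `G_n`. -/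
def restr {n : ℕ} {T : ℝ} (x : C(Set.Icc (0 : ℝ) T, E n)) (t : Set.Icc (0 : ℝ) T) : G n T :=
  ⟨t, x.comp ⟨fun τ => ⟨τ, τ.2.1, τ.2.2.trans t.2.2⟩, by fun_prop⟩⟩

/-- The Riemann–Liouville fractional integral `(I^α ψ)(τ)` with base point `0`; `I^0 ψ = ψ`. -/
def fracInt {F : Type*} [NormedAddCommGroup F] [NormedSpace ℝ F]
    (α : ℝ) (ψ : ℝ → F) (τ : ℝ) : F :=
  if α = 0 then ψ τ
  else (Real.Gamma α)⁻¹ • ∫ ξ in (0 : ℝ)..τ, ((τ - ξ) ^ (1 - α))⁻¹ • ψ ξ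

/-- The function `s ↦ (I^{1-α} (x(·) - x(0)))(s)`, whose derivative is the Caputo derivative. -/
def caputoPrimitive {n : ℕ} (α : ℝ) (x : ℝ → E n) : ℝ → E n :=
  fracInt (1 - α) fun ξ => x ξ - x 0

/-- The Caputo derivative `(^C D^α x)(τ)`. -/
def caputoDeriv {n : ℕ} (α : ℝ) (x : ℝ → E n) (τ : ℝ) : E n :=
  deriv (caputoPrimitive α x) τ

/-- `x ∈ AC^α([0, T], ℝⁿ)`: `x(τ) = x(0) + (I^α ψ)(τ)` on `[0, T]` for some `ψ ∈ L^∞`. -/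
def IsAC {n : ℕ} {T : ℝ} (hT : 0 ≤ T) (α : ℝ) (x : C(Set.Icc (0 : ℝ) T, E n)) : Prop :=
  ∃ ψ : ℝ → E n,
    MeasureTheory.MemLp ψ ⊤ (MeasureTheory.volume.restrict (Set.Icc 0 T)) ∧
      ∀ τ : Set.Icc (0 : ℝ) T, x τ = x (zeroPt hT) + fracInt α ψ (τ : ℝ)

/-- The weighted fractional integral
`(1 / Γ(1-γ)) ∫₀ᵗ e^{-μ (t-τ)^γ} r(τ) / (t-τ)^γ dτ`. -/
def VWeighted (γ μ : ℝ) (t : ℝ) (r : ℝ → ℝ) : ℝ :=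
  (Real.Gamma (1 - γ))⁻¹ *
    ∫ τ in (0 : ℝ)..t, Real.exp (-μ * (t - τ) ^ γ) * r τ / (t - τ) ^ γ

/-- The functional sending `(t, w)` to the weighted fractional integral, with `γ = α + β`,
of `I^β ‖w(·) - w(0)‖²`. -/
def VStar {n : ℕ} {T : ℝ} (α β μ : ℝ) (p : G n T) : ℝ :=
  VWeighted (α + β) μ p.time (fracInt β fun ξ => ‖p.ext ξ - p.init‖ ^ 2)

end FracHJ

end

/-! Write Y = x - x(0) and γ = α + β. The kernel of V*_{β,μ} is the Abel kernel s^{-γ} minus the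
bounded defect (1 - e^{-μ s^γ})/s^γ. By the semigroup law the Abel part gives I^{1-α}‖Y‖², whatever
β is (`VWeighted_fracInt_eq`). Its derivative is at most 2⟨Y, ^CD^α Y⟩: expand ‖Y(τ)‖² about Y(t);
since Y is α-Hölder and the kernel decreases, the quadratic remainder adds at most O(h^{1+α}) to an
increment (`posConv_norm_sq_increment_le`). The defect tends to μ at 0 and changes by at most μ² h
s^{γ-1} between s and s + h (`le_posConv_defectKernel_sub`). Hence, with c = 1/Γ(1-γ) and d = c
Γ(γ), a.e. (`FracLip.deriv_VWeighted_le`) V' ≤ 2⟨Y, ^CD^α Y⟩ - c μ I^β‖Y‖² + d μ² I^{α+2β}‖Y‖².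

The exponents satisfy β_1 = 0 and β_{i+1} = α + 2β_i, so the bad term of index i has the type of the
good term of index i + 1. Taking μ_1 large against mλ and each μ_{i+1} large against μ_i² makes the
sum telescope. What survives is -mλ‖Y‖² and a multiple of I^{β_{m+1}}‖Y‖². As β_{m+1} ≥ 1 - α, the
latter is at most a multiple of I^{1-α}‖Y‖², hence of V*_{β_m,μ_m} (`exists_absorbing_constant`),
and differentiating the factor e^{-λ_* t} absorbs it.

Differentiability a.e. comes from the Lipschitz property, which also needs a lower bound on
increments (`le_posConv_norm_sq_increment`). Continuity on G_n rests on joint continuity of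
evaluation (`G.continuous_uncurry_ext`). Control on compact sets follows because a continuous
functional vanishing only on constant paths has a positive minimum on a compact set of paths away
from them. -/

namespace FracHJ

open MeasureTheory Set Filter Topology intervalIntegral

/-- The function `f` is measurable and essentially bounded by `M` on `(0, T]`. -/
structure BddMeas {F : Type*} [NormedAddCommGroup F] (f : ℝ → F) (T M : ℝ) : Prop where
  meas : AEStronglyMeasurable f (volume.restrict (Ioc 0 T))
  bound : ∀ᵐ ξ ∂(volume.restrict (Ioc 0 T)), ‖f ξ‖ ≤ M

/-- The convolution `∫₀ᵗ K(t - τ) f(τ) dτ` on the half-line. -/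
noncomputable def posConv {F : Type*} [NormedAddCommGroup F] [NormedSpace ℝ F]
    (K : ℝ → ℝ) (f : ℝ → F) (t : ℝ) : F :=
  ∫ τ in (0 : ℝ)..t, K (t - τ) • f τ

/-- The Abel kernel `s ↦ s^{a-1}`, in the form in which it enters `fracInt`. -/
noncomputable def abelKernel (a s : ℝ) : ℝ := (s ^ (1 - a))⁻¹

/-! ### Abel kernels and the Beta integral -/

section Kernel

variable {a b s t : ℝ}

lemma abelKernel_eq_rpow (hs : 0 ≤ s) : abelKernel a s = s ^ (a - 1) := by
  rw [abelKernel, ← Real.rpow_neg hs, neg_sub]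

lemma abelKernel_nonneg (hs : 0 ≤ s) : 0 ≤ abelKernel a s :=
  inv_nonneg.2 (Real.rpow_nonneg hs _)

lemma abelKernel_pos (hs : 0 < s) : 0 < abelKernel a s :=
  inv_pos.2 (Real.rpow_pos_of_pos hs _)

lemma measurable_abelKernel : Measurable (abelKernel a) := by
  unfold abelKernel
  fun_prop

lemma intervalIntegrable_abelKernel (ha : 0 < a) (ht : 0 ≤ t) :
    IntervalIntegrable (abelKernel a) volume 0 t := by
  have h : IntervalIntegrable (fun s : ℝ => s ^ (a - 1)) volume 0 t :=
    intervalIntegrable_rpow' (by linarith)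
  refine h.congr ?_
  rw [uIoc_of_le ht]
  intro s hs
  exact (abelKernel_eq_rpow hs.1.le).symm

lemma integral_abelKernel (ha : 0 < a) (ht : 0 ≤ t) :
    ∫ s in (0 : ℝ)..t, abelKernel a s = t ^ a / a := by
  have : ∫ s in (0 : ℝ)..t, abelKernel a s = ∫ s in (0 : ℝ)..t, s ^ (a - 1) := by
    refine integral_congr fun s hs => ?_
    rw [uIcc_of_le ht] at hs
    exact abelKernel_eq_rpow hs.1
  rw [this, integral_rpow (Or.inl (by linarith))]
  simp [ha.ne']

/-- Euler's Beta integral, scaled to (0, s) and read off from its complex form. -/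
lemma posConv_abelKernel (ha : 0 < a) (hb : 0 < b) (hs : 0 < s) :
    posConv (abelKernel a) (abelKernel b) s =
      Real.Gamma a * Real.Gamma b / Real.Gamma (a + b) * abelKernel (a + b) s := by
  have h1 := Complex.betaIntegral_scaled (b : ℂ) (a : ℂ) hs
  have h2 := Complex.betaIntegral_eq_Gamma_mul_div (b : ℂ) (a : ℂ) (by simpa) (by simpa)
  rw [h2, ← Complex.ofReal_add, Complex.Gamma_ofReal, Complex.Gamma_ofReal,
    Complex.Gamma_ofReal] at h1
  have h3 : ((posConv (abelKernel a) (abelKernel b) s : ℝ) : ℂ) =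
      ∫ x in (0 : ℝ)..s, (x : ℂ) ^ ((b : ℂ) - 1) * ((s : ℂ) - x) ^ ((a : ℂ) - 1) := by
    rw [posConv, ← intervalIntegral.integral_ofReal]
    refine integral_congr fun x hx => ?_
    rw [uIcc_of_le hs.le] at hx
    simp only [smul_eq_mul]
    rw [abelKernel_eq_rpow hx.1, abelKernel_eq_rpow (sub_nonneg.2 hx.2), Complex.ofReal_mul,
      Complex.ofReal_cpow hx.1, Complex.ofReal_cpow (sub_nonneg.2 hx.2), mul_comm]
    push_cast
    rfl
  rw [h1] at h3
  have h4 : (s : ℂ) ^ (((b + a : ℝ) : ℂ) - 1) = ((abelKernel (a + b) s : ℝ) : ℂ) := by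
    rw [abelKernel_eq_rpow hs.le, Complex.ofReal_cpow hs.le, add_comm b a]
    push_cast
    rfl
  rw [h4] at h3
  apply Complex.ofReal_injective
  rw [h3, add_comm b a]
  push_cast
  ring

end Kernel

section

variable {F : Type*} [NormedAddCommGroup F] {f : ℝ → F} {T M : ℝ}

lemma BddMeas.mono {T' : ℝ} (hf : BddMeas f T M) (h : T' ≤ T) : BddMeas f T' M := by
  have hle : volume.restrict (Ioc 0 T') ≤ volume.restrict (Ioc (0 : ℝ) T) :=
    Measure.restrict_mono (Ioc_subset_Ioc_right h) le_rfl
  exact ⟨hf.meas.mono_measure hle, ae_mono hle hf.bound⟩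

lemma BddMeas.of_continuousOn (hf : ContinuousOn f (Icc 0 T)) (h : ∀ ξ ∈ Icc 0 T, ‖f ξ‖ ≤ M) :
    BddMeas f T M := by
  refine ⟨(hf.mono Ioc_subset_Icc_self).aestronglyMeasurable measurableSet_Ioc, ?_⟩
  filter_upwards [ae_restrict_mem measurableSet_Ioc] with ξ hξ
  exact h ξ ⟨hξ.1.le, hξ.2⟩

end

/-! ### Half-line convolutions and the semigroup law -/

section Convolution

variable {F : Type*} [NormedAddCommGroup F] [NormedSpace ℝ F] {K L : ℝ → ℝ} {f g : ℝ → F}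
  {s t T M : ℝ}

lemma fracInt_of_ne_zero {a : ℝ} (ha : a ≠ 0) :
    fracInt a f t = (Real.Gamma a)⁻¹ • posConv (abelKernel a) f t := by
  rw [fracInt, if_neg ha]
  rfl

lemma fracInt_zero : fracInt 0 f = f := by
  funext t
  simp [fracInt]

lemma intervalIntegrable_comp_sub (hK : IntervalIntegrable K volume 0 t) :
    IntervalIntegrable (fun τ => K (t - τ)) volume 0 t := by
  have := (hK.comp_sub_left t).symm
  simpa using this

lemma intervalIntegrable_posConv (ht : 0 ≤ t) (htT : t ≤ T)
    (hK : IntervalIntegrable K volume 0 t) (hf : BddMeas f T M) :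
    IntervalIntegrable (fun τ => K (t - τ) • f τ) volume 0 t := by
  have hK' := intervalIntegrable_comp_sub hK
  rw [intervalIntegrable_iff_integrableOn_Ioc_of_le ht] at hK' ⊢
  have hf' := hf.mono htT
  exact hK'.smul_bdd M hf'.meas hf'.bound

/-- The endpoints are null, so default values of singular kernels at 0 are harmless. -/
lemma posConv_congr (ht : 0 ≤ t) (h : ∀ τ ∈ Ioo 0 t, K (t - τ) • f τ = L (t - τ) • g τ) :
    posConv K f t = posConv L g t := by
  unfold posConv
  rw [integral_of_le ht, integral_of_le ht, integral_Ioc_eq_integral_Ioo,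
    integral_Ioc_eq_integral_Ioo]
  exact setIntegral_congr_fun measurableSet_Ioo h

lemma fracInt_congr {a : ℝ} (ht : 0 ≤ t) (h : ∀ τ ∈ Icc 0 t, f τ = g τ) :
    fracInt a f t = fracInt a g t := by
  by_cases ha : a = 0
  · subst ha
    rw [fracInt_zero, fracInt_zero]
    exact h t ⟨ht, le_rfl⟩
  · rw [fracInt_of_ne_zero ha, fracInt_of_ne_zero ha,
      posConv_congr ht fun τ hτ => by rw [h τ ⟨hτ.1.le, hτ.2.le⟩]]

lemma norm_posConv_le (ht : 0 ≤ t) (htT : t ≤ T) (hK : IntervalIntegrable K volume 0 t)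
    (hf : BddMeas f T M) : ‖posConv K f t‖ ≤ (∫ s in (0 : ℝ)..t, |K s|) * M := by
  have h1 : ‖posConv K f t‖ ≤ ∫ τ in (0 : ℝ)..t, |K (t - τ)| * M := by
    unfold posConv
    refine norm_integral_le_of_norm_le ht ?_ ((intervalIntegrable_comp_sub hK).abs.mul_const M)
    have := (hf.mono htT).bound
    rw [ae_restrict_iff' measurableSet_Ioc] at this
    filter_upwards [this] with τ h hτ
    rw [norm_smul, Real.norm_eq_abs]
    exact mul_le_mul_of_nonneg_left (h hτ) (abs_nonneg _)
  refine h1.trans_eq ?_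
  rw [intervalIntegral.integral_mul_const]
  congr 1
  have := integral_comp_sub_left (fun s => |K s|) t (a := 0) (b := t)
  simpa using this

/-- Associativity of the half-line convolution. -/
lemma posConv_posConv [CompleteSpace F] (ht : 0 ≤ t) (hKm : Measurable K) (hLm : Measurable L)
    (hK : IntervalIntegrable K volume 0 t) (hL : IntervalIntegrable L volume 0 t)
    (hf : BddMeas f t M) :
    posConv K (posConv L f) t = posConv (posConv K L) f t := by
  set ν : Measure ℝ := volume.restrict (Ioc 0 t) with hν
  -- The indicator encodes the triangle ξ < τ, so that Fubini can be applied on the square (0, t]².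
  let Φ : ℝ → ℝ → F := fun τ ξ => (Iio τ).indicator (fun ξ => (K (t - τ) * L (τ - ξ)) • f ξ) ξ
  have hLs : ∀ τ ∈ Ioc 0 t, IntervalIntegrable L volume 0 τ := fun τ hτ =>
    hL.mono_set (by rw [uIcc_of_le hτ.1.le, uIcc_of_le ht]; exact Icc_subset_Icc_right hτ.2)
  have hset : ∀ τ ∈ Ioc 0 t, Iio τ ∩ Ioc 0 t = Ioo 0 τ := by
    intro τ hτ
    ext x
    simp only [mem_inter_iff, mem_Iio, mem_Ioc, mem_Ioo]
    constructor
    · rintro ⟨h1, h2, -⟩; exact ⟨h2, h1⟩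
    · rintro ⟨h1, h2⟩; exact ⟨h2, h1, h2.le.trans hτ.2⟩
  have hinner : ∀ τ ∈ Ioc 0 t, ∫ ξ, Φ τ ξ ∂ν = K (t - τ) • posConv L f τ := by
    intro τ hτ
    rw [hν, MeasureTheory.integral_indicator measurableSet_Iio, Measure.restrict_restrict measurableSet_Iio,
      hset τ hτ, posConv, integral_of_le hτ.1.le, integral_Ioc_eq_integral_Ioo, ← MeasureTheory.integral_smul]
    simp only [mul_smul]
  have hinnerI : ∀ τ ∈ Ioc 0 t, Integrable (Φ τ) ν := by
    intro τ hτ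
    rw [hν, integrable_indicator_iff measurableSet_Iio, IntegrableOn,
      Measure.restrict_restrict measurableSet_Iio, hset τ hτ]
    have := (intervalIntegrable_posConv hτ.1.le hτ.2 (hLs τ hτ) hf).smul (K (t - τ))
    rw [intervalIntegrable_iff_integrableOn_Ioo_of_le hτ.1.le] at this
    simpa only [mul_smul] using! this
  have hmeas : AEStronglyMeasurable (Function.uncurry Φ) (ν.prod ν) := by
    have h1 : AEStronglyMeasurable
        (fun z : ℝ × ℝ => (K (t - z.1) * L (z.1 - z.2)) • f z.2) (ν.prod ν) := by
      refine AEStronglyMeasurable.smul ?_ hf.meas.comp_snd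
      exact Measurable.aestronglyMeasurable (by fun_prop)
    have h2 : Function.uncurry Φ = {z : ℝ × ℝ | z.2 < z.1}.indicator
        (fun z : ℝ × ℝ => (K (t - z.1) * L (z.1 - z.2)) • f z.2) := by
      ext ⟨τ, ξ⟩
      simp [Φ, Function.uncurry, indicator]
    rw [h2]
    exact h1.indicator (measurableSet_lt measurable_snd measurable_fst)
  have hKI : Integrable (fun τ => K (t - τ)) ν :=
    (intervalIntegrable_iff_integrableOn_Ioc_of_le ht).1 (intervalIntegrable_comp_sub hK)
  have hint : Integrable (Function.uncurry Φ) (ν.prod ν) := by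
    rw [integrable_prod_iff hmeas]
    refine ⟨(ae_restrict_mem measurableSet_Ioc).mono hinnerI, ?_⟩
    refine Integrable.mono' (hKI.abs.mul_const ((∫ s in (0 : ℝ)..t, |L s|) * M))
      hmeas.norm.integral_prod_right' ?_
    filter_upwards [ae_restrict_mem measurableSet_Ioc] with τ hτ
    have e : ∀ ξ, ‖Φ τ ξ‖ = |K (t - τ)| * (Iio τ).indicator (fun ξ => ‖L (τ - ξ) • f ξ‖) ξ := by
      intro ξ
      by_cases h : ξ ∈ Iio τ
      · simp [Φ, indicator_of_mem h, norm_smul, mul_assoc]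
      · simp [Φ, indicator_of_notMem h]
    have e2 : ∫ ξ, ‖Φ τ ξ‖ ∂ν = |K (t - τ)| * ∫ ξ in (0 : ℝ)..τ, ‖L (τ - ξ) • f ξ‖ := by
      simp only [e]
      rw [MeasureTheory.integral_const_mul, hν, MeasureTheory.integral_indicator measurableSet_Iio,
        Measure.restrict_restrict measurableSet_Iio, hset τ hτ, integral_of_le hτ.1.le,
        integral_Ioc_eq_integral_Ioo]
    change ‖∫ ξ, ‖Φ τ ξ‖ ∂ν‖ ≤ _
    rw [e2, Real.norm_eq_abs, abs_of_nonneg (mul_nonneg (abs_nonneg _)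
      (intervalIntegral.integral_nonneg hτ.1.le fun _ _ => norm_nonneg _))]
    refine mul_le_mul_of_nonneg_left ?_ (abs_nonneg _)
    have hb : ‖posConv (fun s => |L s|) (fun ξ => ‖f ξ‖) τ‖ ≤ _ := norm_posConv_le hτ.1.le hτ.2
      (hLs τ hτ).abs (⟨hf.meas.norm, by simpa using hf.bound⟩ : BddMeas (fun ξ => ‖f ξ‖) t M)
    -- The sign of `M` is not assumed: (0, t] has positive measure, so `M` bounds a norm at some
    -- point.
    have hM : 0 ≤ M := by
      have hpos : (ae ν).NeBot := by
        rw [ae_neBot, hν, Ne, Measure.restrict_eq_zero, Real.volume_Ioc]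
        simpa using hτ.1.trans_le hτ.2
      obtain ⟨ξ, hξ⟩ := hf.bound.exists
      exact (norm_nonneg _).trans hξ
    have hc : (∫ s in (0 : ℝ)..τ, |L s|) ≤ ∫ s in (0 : ℝ)..t, |L s| :=
      integral_mono_interval le_rfl hτ.1.le hτ.2 (ae_of_all _ fun _ => abs_nonneg _) hL.abs
    have heq : ∫ ξ in (0 : ℝ)..τ, ‖L (τ - ξ) • f ξ‖ =
        posConv (fun s => |L s|) (fun ξ => ‖f ξ‖) τ := by
      unfold posConv
      simp only [norm_smul, Real.norm_eq_abs, smul_eq_mul]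
    rw [heq]
    refine (le_abs_self _).trans (hb.trans ?_)
    simp only [abs_abs]
    exact mul_le_mul_of_nonneg_right hc hM
  have hswap := integral_integral_swap (f := Φ) hint
  have hl : posConv K (posConv L f) t = ∫ τ, ∫ ξ, Φ τ ξ ∂ν ∂ν := by
    rw [posConv, integral_of_le ht]
    exact setIntegral_congr_fun measurableSet_Ioc fun τ hτ => (hinner τ hτ).symm
  rw [hl, hswap, posConv, integral_of_le ht]
  -- After the swap, the inner integral over τ in (ξ, t] becomes the convolution of `K` and `L` at t
  -- - ξ by translation.
  refine setIntegral_congr_fun measurableSet_Ioc fun ξ hξ => ?_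
  have e3 : ∀ τ, Φ τ ξ = (Ioi ξ).indicator (fun τ => K (t - τ) * L (τ - ξ)) τ • f ξ := by
    intro τ
    by_cases h : ξ < τ
    · simp [Φ, indicator, h]
    · simp [Φ, indicator, h]
  have hset2 : Ioi ξ ∩ Ioc 0 t = Ioc ξ t := by
    ext x
    simp only [mem_inter_iff, mem_Ioi, mem_Ioc]
    constructor
    · rintro ⟨h1, -, h2⟩; exact ⟨h1, h2⟩
    · rintro ⟨h1, h2⟩; exact ⟨h1, hξ.1.trans h1, h2⟩
  simp only [e3]
  rw [_root_.integral_smul_const, hν, MeasureTheory.integral_indicator measurableSet_Ioi,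
    Measure.restrict_restrict measurableSet_Ioi, hset2, ← integral_of_le hξ.2]
  congr 1
  have := integral_comp_sub_right (fun s => K (t - ξ - s) * L s) ξ (a := ξ) (b := t)
  rw [sub_self] at this
  rw [posConv]
  simp only [smul_eq_mul]
  rw [← this]
  simp

/-- The semigroup property of the Riemann–Liouville integrals. -/
lemma fracInt_fracInt [CompleteSpace F] {a b : ℝ} (ha : 0 < a) (hb : 0 ≤ b) (ht : 0 ≤ t)
    (hf : BddMeas f t M) : fracInt a (fracInt b f) t = fracInt (a + b) f t := by
  rcases hb.eq_or_lt with rfl | hb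
  · rw [fracInt_zero, add_zero]
  have h : fracInt b f = fun τ => (Real.Gamma b)⁻¹ • posConv (abelKernel b) f τ :=
    funext fun τ => fracInt_of_ne_zero hb.ne'
  have hsm : posConv (abelKernel a) (fracInt b f) t =
      (Real.Gamma b)⁻¹ • posConv (abelKernel a) (posConv (abelKernel b) f) t := by
    rw [h]
    simp only [posConv]
    rw [← intervalIntegral.integral_smul]
    simp only [smul_comm (Real.Gamma b)⁻¹]
  have hc : posConv (posConv (abelKernel a) (abelKernel b)) f t =
      (Real.Gamma a * Real.Gamma b / Real.Gamma (a + b)) • posConv (abelKernel (a + b)) f t := by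
    rw [posConv_congr ht (L := fun s => Real.Gamma a * Real.Gamma b / Real.Gamma (a + b) *
      abelKernel (a + b) s) (g := f)]
    · simp only [posConv]
      rw [← intervalIntegral.integral_smul]
      simp only [mul_smul]
    · intro τ hτ
      rw [posConv_abelKernel ha hb (sub_pos.2 hτ.2)]
  rw [fracInt_of_ne_zero ha.ne', hsm, posConv_posConv ht measurable_abelKernel
    measurable_abelKernel (intervalIntegrable_abelKernel ha ht)
    (intervalIntegrable_abelKernel hb ht) hf, hc, fracInt_of_ne_zero (by positivity), smul_smul,
    smul_smul]
  congr 1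
  have h1 := (Real.Gamma_pos_of_pos ha).ne'
  have h2 := (Real.Gamma_pos_of_pos hb).ne'
  field_simp

end Convolution

section

variable {F : Type*} [NormedAddCommGroup F] {s t : ℝ}

lemma intervalIntegrable_mono_right {g : ℝ → F} (hg : IntervalIntegrable g volume 0 t)
    (hs : 0 ≤ s) (hst : s ≤ t) : IntervalIntegrable g volume 0 s :=
  hg.mono_set (by rw [uIcc_of_le hs, uIcc_of_le (hs.trans hst)]; exact Icc_subset_Icc_right hst)

lemma intervalIntegrable_mono_left {g : ℝ → F} (hg : IntervalIntegrable g volume 0 t)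
    (hs : 0 ≤ s) (hst : s ≤ t) : IntervalIntegrable g volume s t :=
  hg.mono_set (by rw [uIcc_of_le hst, uIcc_of_le (hs.trans hst)]; exact Icc_subset_Icc_left hs)

end

/-! ### Increments of convolutions and Hölder estimates -/

section Increments

variable {F : Type*} [NormedAddCommGroup F] [NormedSpace ℝ F] {K : ℝ → ℝ} {f : ℝ → F}
  {a h s t T M : ℝ}

/-- Every increment estimate below starts from this splitting: the newly covered interval, where the
kernel is near its singularity, and the change of the kernel over the past. -/
lemma posConv_sub (ht : 0 ≤ t) (hh : 0 ≤ h) (hT : t + h ≤ T)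
    (hK : IntervalIntegrable K volume 0 (t + h)) (hf : BddMeas f T M) :
    posConv K f (t + h) - posConv K f t =
      (∫ τ in t..(t + h), K (t + h - τ) • f τ) +
        ∫ τ in (0 : ℝ)..t, (K (t + h - τ) - K (t - τ)) • f τ := by
  have i1 := intervalIntegrable_posConv (by linarith) hT hK hf
  have i2 := intervalIntegrable_posConv ht (by linarith)
    (intervalIntegrable_mono_right hK ht (by linarith)) hf
  have i3 := intervalIntegrable_mono_right i1 ht (by linarith)
  have i4 := intervalIntegrable_mono_left i1 ht (by linarith)
  simp only [sub_smul]
  rw [intervalIntegral.integral_sub i3 i2, posConv, posConv, ← integral_add_adjacent_intervals i3 i4]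
  abel

lemma integral_kernel_right (t h : ℝ) :
    ∫ τ in t..(t + h), K (t + h - τ) = ∫ s in (0 : ℝ)..h, K s := by
  rw [integral_comp_sub_left K (t + h)]
  simp

lemma integral_kernel_left (hK : IntervalIntegrable K volume 0 (t + h)) (ht : 0 ≤ t)
    (hh : 0 ≤ h) :
    ∫ τ in (0 : ℝ)..t, K (t + h - τ) =
      (∫ s in (0 : ℝ)..(t + h), K s) - ∫ s in (0 : ℝ)..h, K s := by
  rw [integral_comp_sub_left K (t + h)]
  simp only [add_sub_cancel_left, sub_zero]
  rw [integral_interval_sub_left hK (intervalIntegrable_mono_right hK hh (by linarith))]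

lemma integral_kernel_reflect (t : ℝ) :
    ∫ τ in (0 : ℝ)..t, K (t - τ) = ∫ s in (0 : ℝ)..t, K s := by
  rw [integral_comp_sub_left K t]
  simp

lemma abelKernel_le_of_le (ha1 : a ≤ 1) (hs : 0 < s) (hst : s ≤ t) :
    abelKernel a t ≤ abelKernel a s := by
  unfold abelKernel
  exact inv_anti₀ (Real.rpow_pos_of_pos hs _)
    (Real.rpow_le_rpow hs.le hst (by linarith))

/-- Bernoulli's inequality for (1 + h/s)^p, with the factor p ≤ 1 discarded. -/
lemma rpow_add_sub_le {p : ℝ} (hp0 : 0 ≤ p) (hp1 : p ≤ 1) (hs : 0 < s) (hh : 0 ≤ h) :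
    (s + h) ^ p - s ^ p ≤ h * s ^ (p - 1) := by
  have h1 : s + h = s * (1 + h / s) := by field_simp
  have h2 := rpow_one_add_le_one_add_mul_self (s := h / s) (by
    have : 0 ≤ h / s := by positivity
    linarith) hp0 hp1
  have h3 : 0 ≤ h / s := by positivity
  rw [h1, Real.mul_rpow hs.le (by linarith), Real.rpow_sub_one hs.ne']
  have h4 : (1 + h / s) ^ p ≤ 1 + h / s := h2.trans (by nlinarith)
  have h5 := Real.rpow_nonneg hs.le p
  calc s ^ p * (1 + h / s) ^ p - s ^ p ≤ s ^ p * (1 + h / s) - s ^ p := by gcongr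
    _ = h * (s ^ p / s) := by ring

lemma abelKernel_sub_le (ha0 : 0 ≤ a) (ha1 : a ≤ 1) (hs : 0 < s) (hh : 0 ≤ h) :
    abelKernel a s - abelKernel a (s + h) ≤ h * s ^ (a - 2) := by
  have hsh : 0 < s + h := by linarith
  have h1 := rpow_add_sub_le (p := 1 - a) (by linarith) (by linarith) hs hh
  have h2 : s ^ (1 - a) ≤ (s + h) ^ (1 - a) := Real.rpow_le_rpow hs.le (by linarith) (by linarith)
  have p1 := Real.rpow_pos_of_pos hs (1 - a)
  have p2 := Real.rpow_pos_of_pos hsh (1 - a)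
  have e : s ^ (a - 2) = s ^ (1 - a - 1) / s ^ (1 - a) / s ^ (1 - a) := by
    rw [← Real.rpow_sub hs, ← Real.rpow_sub hs]
    congr 1
    ring
  unfold abelKernel
  rw [inv_sub_inv p1.ne' p2.ne', e]
  calc ((s + h) ^ (1 - a) - s ^ (1 - a)) / (s ^ (1 - a) * (s + h) ^ (1 - a))
      ≤ (h * s ^ (1 - a - 1)) / (s ^ (1 - a) * s ^ (1 - a)) := by gcongr
    _ = _ := by field_simp

/-- Fractional integrals of bounded functions are Hölder continuous. -/
lemma norm_posConv_abelKernel_sub_le (ha0 : 0 < a) (ha1 : a ≤ 1) (ht : 0 ≤ t) (hh : 0 ≤ h)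
    (hT : t + h ≤ T) (hM : 0 ≤ M) (hf : BddMeas f T M) :
    ‖posConv (abelKernel a) f (t + h) - posConv (abelKernel a) f t‖ ≤ 2 * M / a * h ^ a := by
  have hth : 0 ≤ t + h := by linarith
  have hK := intervalIntegrable_abelKernel ha0 hth
  have hKt := intervalIntegrable_abelKernel ha0 ht
  have hb := (ae_restrict_iff' measurableSet_Ioc).1 hf.bound
  have i1 := intervalIntegrable_comp_sub hK
  have i2 := intervalIntegrable_comp_sub hKt
  rw [posConv_sub ht hh hT hK hf]
  have e1 : ‖∫ τ in t..(t + h), abelKernel a (t + h - τ) • f τ‖ ≤ M / a * h ^ a := by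
    have : ‖∫ τ in t..(t + h), abelKernel a (t + h - τ) • f τ‖ ≤
        ∫ τ in t..(t + h), abelKernel a (t + h - τ) * M := by
      refine norm_integral_le_of_norm_le (by linarith) ?_
        ((intervalIntegrable_mono_left i1 ht (by linarith)).mul_const M)
      filter_upwards [hb] with τ hτ hτ'
      rw [norm_smul, Real.norm_of_nonneg (abelKernel_nonneg (by linarith [hτ'.2]))]
      exact mul_le_mul_of_nonneg_left (hτ ⟨by linarith [hτ'.1], by linarith [hτ'.2]⟩)
        (abelKernel_nonneg (by linarith [hτ'.2]))
    rw [intervalIntegral.integral_mul_const, integral_kernel_right, integral_abelKernel ha0 hh] at this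
    refine this.trans_eq (by ring)
  -- The kernel difference has constant sign, so its total mass is (t^a - (t+h)^a + h^a)/a ≤ h^a/a.
  have e2 : ‖∫ τ in (0 : ℝ)..t, (abelKernel a (t + h - τ) - abelKernel a (t - τ)) • f τ‖ ≤
      M / a * h ^ a := by
    have : ‖∫ τ in (0 : ℝ)..t, (abelKernel a (t + h - τ) - abelKernel a (t - τ)) • f τ‖ ≤
        ∫ τ in (0 : ℝ)..t, (abelKernel a (t - τ) - abelKernel a (t + h - τ)) * M := by
      refine norm_integral_le_of_norm_le ht ?_
        ((i2.sub (intervalIntegrable_mono_right i1 ht (by linarith))).mul_const M)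
      -- At τ = t and a < 1 the kernel takes the default value 0 and monotonicity fails.
      have hne : ∀ᵐ τ : ℝ, τ ≠ t := by simp [ae_iff]
      filter_upwards [hb, hne] with τ hτ hne hτ'
      have hpos : 0 < t - τ := sub_pos.2 (lt_of_le_of_ne hτ'.2 hne)
      have := abelKernel_le_of_le ha1 hpos (by linarith : t - τ ≤ t + h - τ)
      rw [norm_smul, Real.norm_eq_abs, abs_sub_comm, abs_of_nonneg (by linarith)]
      exact mul_le_mul_of_nonneg_left (hτ ⟨hτ'.1, by linarith [hτ'.2]⟩) (by linarith)
    rw [intervalIntegral.integral_mul_const, intervalIntegral.integral_sub i2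
      (intervalIntegrable_mono_right i1 ht (by linarith)), integral_kernel_reflect,
      integral_kernel_left hK ht hh, integral_abelKernel ha0 hh, integral_abelKernel ha0 hth,
      integral_abelKernel ha0 ht] at this
    refine this.trans ?_
    have hmono : t ^ a ≤ (t + h) ^ a := Real.rpow_le_rpow ht (by linarith) ha0.le
    have : t ^ a / a - ((t + h) ^ a / a - h ^ a / a) ≤ h ^ a / a := by
      have : t ^ a / a ≤ (t + h) ^ a / a := by gcongr
      linarith
    calc _ ≤ h ^ a / a * M := by gcongr
      _ = M / a * h ^ a := by ring
  calc _ ≤ _ := norm_add_le _ _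
    _ ≤ M / a * h ^ a + M / a * h ^ a := add_le_add e1 e2
    _ = 2 * M / a * h ^ a := by ring

end Increments

/-! ### Squared norms: comparison with the linear increments -/

section Quadratic

variable {F : Type*} [NormedAddCommGroup F] [InnerProductSpace ℝ F] [CompleteSpace F]
  {Y : ℝ → F} {α H h t t' T : ℝ}

/-- Expansion of the square about y. For y = Y t the last term is quadratic in the increments of Y,
hence small where the kernel is singular. -/
lemma posConv_norm_sq_eq (hY : ContinuousOn Y (Icc 0 T)) {K : ℝ → ℝ} (ht' : 0 ≤ t')
    (hT' : t' ≤ T)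
    (hK : IntervalIntegrable K volume 0 t') (y : F) :
    posConv K (fun τ => ‖Y τ‖ ^ 2) t' =
      -(‖y‖ ^ 2 * ∫ s in (0 : ℝ)..t', K s) + 2 * inner ℝ y (posConv K Y t') +
        posConv K (fun τ => ‖Y τ - y‖ ^ 2) t' := by
  obtain ⟨B, hB⟩ := isCompact_Icc.exists_bound_of_continuousOn hY
  have i1 := intervalIntegrable_posConv ht' hT' hK (BddMeas.of_continuousOn hY hB)
  have hq : ContinuousOn (fun τ => ‖Y τ - y‖ ^ 2) (Icc 0 T) := by fun_prop
  obtain ⟨B', hB'⟩ := isCompact_Icc.exists_bound_of_continuousOn hq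
  have i2 := intervalIntegrable_posConv ht' hT' hK (BddMeas.of_continuousOn hq hB')
  have i0 := intervalIntegrable_comp_sub hK
  have e1 : inner ℝ y (posConv K Y t') = ∫ τ in (0 : ℝ)..t', inner ℝ y (K (t' - τ) • Y τ) := by
    rw [posConv]
    exact ((innerSL ℝ y).intervalIntegral_comp_comm i1).symm
  have i3 : IntervalIntegrable (fun τ => inner ℝ y (K (t' - τ) • Y τ)) volume 0 t' := by
    rw [intervalIntegrable_iff] at i1 ⊢
    exact (innerSL ℝ y).integrable_comp i1
  have i4 : IntervalIntegrable (fun τ => -(‖y‖ ^ 2 * K (t' - τ))) volume 0 t' :=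
    (i0.const_mul _).neg
  rw [e1, ← integral_kernel_reflect, ← intervalIntegral.integral_const_mul,
    ← intervalIntegral.integral_const_mul, ← intervalIntegral.integral_neg, posConv, posConv,
    ← intervalIntegral.integral_add i4 (i3.const_mul 2),
    ← intervalIntegral.integral_add (i4.add (i3.const_mul 2)) i2]
  refine integral_congr fun τ _ => ?_
  simp only [smul_eq_mul, inner_smul_right]
  rw [norm_sub_sq_real, real_inner_comm]
  ring

/-- The increments of `I^{1-α}‖y‖²` against those of `I^{1-α}y`, for an `α`-Hölder path `y`:
upper bound. -/
lemma posConv_norm_sq_increment_le (hα0 : 0 < α) (hα1 : α < 1)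
    (hY : ContinuousOn Y (Icc 0 T)) (hH0 : 0 ≤ H)
    (hH : ∀ s ∈ Icc 0 T, ∀ t ∈ Icc 0 T, ‖Y t - Y s‖ ≤ H * |t - s| ^ α)
    (ht : 0 ≤ t) (hh : 0 ≤ h) (hT : t + h ≤ T) :
    posConv (abelKernel (1 - α)) (fun τ => ‖Y τ‖ ^ 2) (t + h) -
        posConv (abelKernel (1 - α)) (fun τ => ‖Y τ‖ ^ 2) t ≤
      2 * inner ℝ (Y t) (posConv (abelKernel (1 - α)) Y (t + h) -
          posConv (abelKernel (1 - α)) Y t) + H ^ 2 / (1 - α) * h ^ (1 + α) := by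
  have hth : 0 ≤ t + h := by linarith
  have hα' : 0 < 1 - α := by linarith
  have hK := intervalIntegrable_abelKernel hα' hth
  have hKt := intervalIntegrable_abelKernel hα' ht
  have hq : ContinuousOn (fun τ => ‖Y τ - Y t‖ ^ 2) (Icc 0 T) := by fun_prop
  obtain ⟨B, hB⟩ := isCompact_Icc.exists_bound_of_continuousOn hq
  have hqB := BddMeas.of_continuousOn hq hB
  have i1 := intervalIntegrable_posConv hth hT hK hqB
  have htm : t ∈ Icc 0 T := ⟨ht, by linarith⟩
  rw [posConv_norm_sq_eq hY hth hT hK (Y t), posConv_norm_sq_eq hY ht (by linarith) hKt (Y t),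
    inner_sub_right, integral_abelKernel hα' hth, integral_abelKernel hα' ht]
  have hs := posConv_sub ht hh hT hK hqB
  -- The remainder is at most H² h^{2α} here and the kernel has mass h^{1-α}/(1-α).
  have e1 : (∫ τ in t..(t + h), abelKernel (1 - α) (t + h - τ) • ‖Y τ - Y t‖ ^ 2) ≤
      H ^ 2 / (1 - α) * h ^ (1 + α) := by
    have i2 := intervalIntegrable_mono_left (intervalIntegrable_comp_sub hK) ht
      (by linarith : t ≤ t + h)
    calc _ ≤ ∫ τ in t..(t + h), abelKernel (1 - α) (t + h - τ) * (H * h ^ α) ^ 2 := by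
          refine integral_mono_on (by linarith)
            (intervalIntegrable_mono_left i1 ht (by linarith)) (i2.mul_const _) ?_
          intro τ hτ
          refine mul_le_mul_of_nonneg_left ?_ (abelKernel_nonneg (by linarith [hτ.2]))
          have hb := hH t htm τ ⟨by linarith [hτ.1], by linarith [hτ.2]⟩
          refine pow_le_pow_left₀ (norm_nonneg _) (hb.trans ?_) 2
          refine mul_le_mul_of_nonneg_left (Real.rpow_le_rpow (abs_nonneg _) ?_ hα0.le) hH0
          rw [abs_of_nonneg (by linarith [hτ.1])]
          linarith [hτ.2]
      _ = _ := by
          rw [intervalIntegral.integral_mul_const, integral_kernel_right,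
            integral_abelKernel hα' hh]
          have : h ^ (1 + α) = h ^ (1 - α) * (h ^ α) ^ 2 := by
            rw [← Real.rpow_natCast, ← Real.rpow_mul hh, ← Real.rpow_add_of_nonneg hh hα'.le (by positivity)]
            congr 1
            push_cast
            ring
          rw [this]
          ring
  -- The kernel decreases, so the past contributes with a favourable sign.
  have e2 : (∫ τ in (0 : ℝ)..t, (abelKernel (1 - α) (t + h - τ) - abelKernel (1 - α) (t - τ)) •
      ‖Y τ - Y t‖ ^ 2) ≤ 0 := by
    rw [integral_of_le ht, integral_Ioc_eq_integral_Ioo]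
    refine setIntegral_nonpos measurableSet_Ioo fun τ hτ => ?_
    refine mul_nonpos_of_nonpos_of_nonneg ?_ (by positivity)
    have := abelKernel_le_of_le (a := 1 - α) (by linarith) (sub_pos.2 hτ.2)
      (by linarith : t - τ ≤ t + h - τ)
    linarith
  have e3 : t ^ (1 - α) / (1 - α) ≤ (t + h) ^ (1 - α) / (1 - α) := by
    gcongr
    linarith
  nlinarith [sq_nonneg ‖Y t‖, mul_le_mul_of_nonneg_left e3 (sq_nonneg ‖Y t‖)]

/-- The increments of `I^{1-α}‖y‖²` against those of `I^{1-α}y`, for an `α`-Hölder path `y`: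
lower bound. -/
lemma le_posConv_norm_sq_increment (hα0 : 0 < α) (hα1 : α < 1)
    (hY : ContinuousOn Y (Icc 0 T)) (hY0 : Y 0 = 0)
    (hH : ∀ s ∈ Icc 0 T, ∀ t ∈ Icc 0 T, ‖Y t - Y s‖ ≤ H * |t - s| ^ α)
    (ht : 0 ≤ t) (hh : 0 ≤ h) (hT : t + h ≤ T) :
    2 * inner ℝ (Y t) (posConv (abelKernel (1 - α)) Y (t + h) -
          posConv (abelKernel (1 - α)) Y t) -
        H ^ 2 * T ^ α * (1 / α + 1 / (1 - α)) * h ≤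
      posConv (abelKernel (1 - α)) (fun τ => ‖Y τ‖ ^ 2) (t + h) -
        posConv (abelKernel (1 - α)) (fun τ => ‖Y τ‖ ^ 2) t := by
  have hth : 0 ≤ t + h := by linarith
  have hT0 : 0 ≤ T := by linarith
  have hα' : 0 < 1 - α := by linarith
  have hK := intervalIntegrable_abelKernel hα' hth
  have hKt := intervalIntegrable_abelKernel hα' ht
  have hq : ContinuousOn (fun τ => ‖Y τ - Y t‖ ^ 2) (Icc 0 T) := by fun_prop
  obtain ⟨B, hB⟩ := isCompact_Icc.exists_bound_of_continuousOn hq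
  have hqB := BddMeas.of_continuousOn hq hB
  have i1 := intervalIntegrable_posConv hth hT hK hqB
  have i2 := intervalIntegrable_posConv ht (by linarith) hKt hqB
  have htm : t ∈ Icc 0 T := ⟨ht, by linarith⟩
  have htα : t ^ α ≤ T ^ α := Real.rpow_le_rpow ht htm.2 hα0.le
  rw [posConv_norm_sq_eq hY hth hT hK (Y t), posConv_norm_sq_eq hY ht (by linarith) hKt (Y t),
    inner_sub_right, integral_abelKernel hα' hth, integral_abelKernel hα' ht]
  have hs := posConv_sub ht hh hT hK hqB
  have e1 : 0 ≤ (∫ τ in t..(t + h), abelKernel (1 - α) (t + h - τ) • ‖Y τ - Y t‖ ^ 2) :=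
    intervalIntegral.integral_nonneg (by linarith) fun τ hτ =>
      mul_nonneg (abelKernel_nonneg (by linarith [hτ.2])) (by positivity)
  -- The kernel drops by at most h s^{-1-α}, and the remainder is at most H² s^{2α}; the product h
  -- H² s^{α-1} is integrable.
  have e2 : -(H ^ 2 * T ^ α / α * h) ≤
      ∫ τ in (0 : ℝ)..t, (abelKernel (1 - α) (t + h - τ) - abelKernel (1 - α) (t - τ)) •
        ‖Y τ - Y t‖ ^ 2 := by
    have i3 : IntervalIntegrable (fun τ => abelKernel α (t - τ)) volume 0 t :=
      intervalIntegrable_comp_sub (intervalIntegrable_abelKernel hα0 ht)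
    calc -(H ^ 2 * T ^ α / α * h) ≤ -(H ^ 2 * t ^ α / α * h) := by gcongr
      _ = ∫ τ in (0 : ℝ)..t, abelKernel α (t - τ) * (-(h * H ^ 2)) := by
          rw [intervalIntegral.integral_mul_const, integral_kernel_reflect,
            integral_abelKernel hα0 ht]
          ring
      _ ≤ _ := by
          have i4 : IntervalIntegrable (fun τ => (abelKernel (1 - α) (t + h - τ) -
              abelKernel (1 - α) (t - τ)) • ‖Y τ - Y t‖ ^ 2) volume 0 t := by
            simp only [sub_smul]
            exact (intervalIntegrable_mono_right i1 ht (by linarith)).sub i2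
          rw [integral_of_le ht, integral_of_le ht, integral_Ioc_eq_integral_Ioo,
            integral_Ioc_eq_integral_Ioo]
          refine setIntegral_mono_on
            ((intervalIntegrable_iff_integrableOn_Ioo_of_le ht).1 (i3.mul_const _))
            ((intervalIntegrable_iff_integrableOn_Ioo_of_le ht).1 i4) measurableSet_Ioo ?_
          intro τ hτ
          have hp : 0 < t - τ := sub_pos.2 hτ.2
          have h1 := abelKernel_sub_le (a := 1 - α) hα'.le (by linarith) hp hh
          have h2 : ‖Y τ - Y t‖ ^ 2 ≤ (H * (t - τ) ^ α) ^ 2 := by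
            refine pow_le_pow_left₀ (norm_nonneg _) ?_ 2
            have := hH t htm τ ⟨hτ.1.le, by linarith [hτ.2]⟩
            rwa [abs_sub_comm, abs_of_pos hp] at this
          have h3 : (abelKernel (1 - α) (t - τ) - abelKernel (1 - α) (t + h - τ)) *
              ‖Y τ - Y t‖ ^ 2 ≤ h * (t - τ) ^ (1 - α - 2) * (H * (t - τ) ^ α) ^ 2 := by
            rw [show t + h - τ = t - τ + h by ring]
            exact mul_le_mul h1 h2 (by positivity) (by positivity)
          have h4 : (t - τ) ^ (1 - α - 2) * ((t - τ) ^ α) ^ 2 = abelKernel α (t - τ) := by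
            rw [abelKernel_eq_rpow hp.le, ← Real.rpow_natCast, ← Real.rpow_mul hp.le,
              ← Real.rpow_add hp]
            congr 1
            push_cast
            ring
          simp only [smul_eq_mul]
          rw [← h4]
          linarith [h3]
  -- The factor t^{-α} from the increment of the power is singular at 0, but Y 0 = 0 gives ‖Y t‖² ≤
  -- H² t^{2α}.
  have e3 : ‖Y t‖ ^ 2 * ((t + h) ^ (1 - α) / (1 - α) - t ^ (1 - α) / (1 - α)) ≤
      H ^ 2 * T ^ α / (1 - α) * h := by
    rcases ht.eq_or_lt with rfl | htp
    · rw [hY0]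
      simp only [norm_zero, ne_eq, OfNat.ofNat_ne_zero, not_false_eq_true, zero_pow, zero_mul]
      positivity
    · have h1 := rpow_add_sub_le (p := 1 - α) hα'.le (by linarith) htp hh
      have h2 : ‖Y t‖ ^ 2 ≤ (H * t ^ α) ^ 2 := by
        refine pow_le_pow_left₀ (norm_nonneg _) ?_ 2
        have := hH 0 ⟨le_rfl, hT0⟩ t htm
        rwa [hY0, sub_zero, sub_zero, abs_of_pos htp] at this
      have h4 : t ^ (1 - α - 1) * (t ^ α) ^ 2 = t ^ α := by
        rw [← Real.rpow_natCast, ← Real.rpow_mul ht, ← Real.rpow_add htp]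
        congr 1
        push_cast
        ring
      rw [← sub_div]
      calc ‖Y t‖ ^ 2 * (((t + h) ^ (1 - α) - t ^ (1 - α)) / (1 - α))
          ≤ (H * t ^ α) ^ 2 * ((h * t ^ (1 - α - 1)) / (1 - α)) := by
            refine mul_le_mul h2 (by gcongr) ?_ (by positivity)
            refine div_nonneg (sub_nonneg.2 ?_) hα'.le
            exact Real.rpow_le_rpow ht (by linarith) hα'.le
        _ = H ^ 2 * (t ^ (1 - α - 1) * (t ^ α) ^ 2) / (1 - α) * h := by ring
        _ ≤ _ := by rw [h4]; gcongr
  have e4 : H ^ 2 * T ^ α * (1 / α + 1 / (1 - α)) * h =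
      H ^ 2 * T ^ α / α * h + H ^ 2 * T ^ α / (1 - α) * h := by ring
  rw [e4]
  linarith

end Quadratic

/-- The defect `(1 - e^{-μ s^γ}) / s^γ` of the weighted kernel with respect to the Abel kernel. -/
noncomputable def defectKernel (γ μ s : ℝ) : ℝ := (1 - Real.exp (-μ * s ^ γ)) * abelKernel (1 - γ) s

/-! ### Bounds for the defect kernel -/

section DefectKernel

variable {γ μ s h u v : ℝ}

lemma measurable_defectKernel : Measurable (defectKernel γ μ) := by
  have := measurable_abelKernel (a := 1 - γ)
  unfold defectKernel
  fun_prop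

/-- Mean value inequality: the derivative of (1 - e^{-x})/x has absolute value at most 1 for x > 0.
-/
lemma one_sub_exp_neg_div_sub_le (hu : 0 < u) (huv : u ≤ v) :
    |(1 - Real.exp (-v)) / v - (1 - Real.exp (-u)) / u| ≤ v - u := by
  have hd : ∀ x ∈ Icc u v, HasDerivWithinAt (fun x => (1 - Real.exp (-x)) / x)
      ((Real.exp (-x) * x - (1 - Real.exp (-x))) / x ^ 2) (Icc u v) x := by
    intro x hx
    have hx0 : x ≠ 0 := (hu.trans_le hx.1).ne'
    have h1 : HasDerivAt (fun x => 1 - Real.exp (-x)) (Real.exp (-x)) x := by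
      simpa using ((hasDerivAt_neg x).exp).const_sub 1
    have h2 := (h1.fun_div (hasDerivAt_id' x) hx0).hasDerivWithinAt (s := Icc u v)
    simpa only [mul_one] using h2
  have hb : ∀ x ∈ Icc u v, ‖(Real.exp (-x) * x - (1 - Real.exp (-x))) / x ^ 2‖ ≤ 1 := by
    intro x hx
    have hx0 : 0 < x := hu.trans_le hx.1
    have h1 := Real.add_one_le_exp (-x)
    have h2 : Real.exp (-x) * (1 + x) ≤ 1 := by
      have := Real.add_one_le_exp x
      calc Real.exp (-x) * (1 + x) ≤ Real.exp (-x) * Real.exp x := by gcongr; linarith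
        _ = 1 := by rw [← Real.exp_add]; simp
    rw [Real.norm_eq_abs, abs_div, abs_of_pos (by positivity : (0 : ℝ) < x ^ 2),
      div_le_one (by positivity), abs_le]
    constructor
    · nlinarith
    · nlinarith [sq_nonneg x]
  have := (convex_Icc u v).norm_image_sub_le_of_norm_hasDerivWithin_le hd hb
    (left_mem_Icc.2 huv) (right_mem_Icc.2 huv)
  rw [Real.norm_eq_abs, Real.norm_eq_abs, abs_of_nonneg (sub_nonneg.2 huv), one_mul] at this
  exact this

/-- With φ(u) = (1 - e^{-u})/u the kernel is μ φ(μ s^γ), which reduces its bounds to those of φ.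
Where s^γ = 0, both sides are 0 by the conventions for division. -/
lemma defectKernel_eq (hμ : μ ≠ 0) :
    defectKernel γ μ s = μ * ((1 - Real.exp (-(μ * s ^ γ))) / (μ * s ^ γ)) := by
  rw [defectKernel, abelKernel, sub_sub_cancel, neg_mul]
  by_cases h : s ^ γ = 0
  · simp [h]
  · field_simp

lemma defectKernel_nonneg (hμ : 0 ≤ μ) (hs : 0 ≤ s) : 0 ≤ defectKernel γ μ s := by
  refine mul_nonneg (sub_nonneg.2 (Real.exp_le_one_iff.2 ?_)) (abelKernel_nonneg hs)
  have : 0 ≤ s ^ γ := Real.rpow_nonneg hs _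
  nlinarith

lemma defectKernel_le (hμ : 0 < μ) (hs : 0 ≤ s) : defectKernel γ μ s ≤ μ := by
  rw [defectKernel_eq hμ.ne']
  have h0 : 0 ≤ μ * s ^ γ := mul_nonneg hμ.le (Real.rpow_nonneg hs _)
  have h1 := Real.add_one_le_exp (-(μ * s ^ γ))
  have h2 : (1 - Real.exp (-(μ * s ^ γ))) / (μ * s ^ γ) ≤ 1 := div_le_one_of_le₀ (by linarith) h0
  nlinarith

lemma le_defectKernel (hμ : 0 < μ) (hs : 0 < s) : μ - μ ^ 2 * s ^ γ ≤ defectKernel γ μ s := by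
  rw [defectKernel_eq hμ.ne']
  have h0 : 0 < μ * s ^ γ := mul_pos hμ (Real.rpow_pos_of_pos hs _)
  set u := μ * s ^ γ with hu
  have h2 : Real.exp (-u) * (1 + u) ≤ 1 := by
    have := Real.add_one_le_exp u
    calc Real.exp (-u) * (1 + u) ≤ Real.exp (-u) * Real.exp u := by gcongr; linarith
      _ = 1 := by rw [← Real.exp_add]; simp
  -- Otherwise e^{-u} > 1 - u + u², and multiplying by 1 + u gives 1 + u³ < 1.
  have h3 : 1 - u ≤ (1 - Real.exp (-u)) / u := by
    rw [le_div_iff₀ h0]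
    by_contra hc
    push Not at hc
    have : (1 - u + u ^ 2) * (1 + u) < Real.exp (-u) * (1 + u) := by
      apply mul_lt_mul_of_pos_right _ (by linarith)
      nlinarith
    nlinarith [pow_pos h0 3]
  calc μ - μ ^ 2 * s ^ γ = μ * (1 - u) := by rw [hu]; ring
    _ ≤ _ := by gcongr

lemma abs_defectKernel_sub_le (hγ0 : 0 ≤ γ) (hγ1 : γ ≤ 1) (hμ : 0 < μ) (hs : 0 < s) (hh : 0 ≤ h) :
    |defectKernel γ μ (s + h) - defectKernel γ μ s| ≤ μ ^ 2 * h * abelKernel γ s := by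
  rw [defectKernel_eq hμ.ne', defectKernel_eq hμ.ne', ← mul_sub, abs_mul, abs_of_pos hμ,
    abelKernel_eq_rpow hs.le]
  have h1 : μ * s ^ γ ≤ μ * (s + h) ^ γ := by gcongr; linarith
  have h2 := one_sub_exp_neg_div_sub_le (mul_pos hμ (Real.rpow_pos_of_pos hs γ)) h1
  have h3 := rpow_add_sub_le hγ0 hγ1 hs hh
  calc _ ≤ μ * (μ * (s + h) ^ γ - μ * s ^ γ) := by gcongr
    _ = μ ^ 2 * ((s + h) ^ γ - s ^ γ) := by ring
    _ ≤ μ ^ 2 * (h * s ^ (γ - 1)) := by gcongr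
    _ = _ := by ring

lemma intervalIntegrable_defectKernel (hμ : 0 < μ) (hs : 0 ≤ s) :
    IntervalIntegrable (defectKernel γ μ) volume 0 s := by
  rw [intervalIntegrable_iff_integrableOn_Ioc_of_le hs]
  refine Measure.integrableOn_of_bounded (M := μ) (by simp) measurable_defectKernel.aestronglyMeasurable ?_
  filter_upwards [ae_restrict_mem measurableSet_Ioc] with x hx
  rw [Real.norm_of_nonneg (defectKernel_nonneg hμ.le hx.1.le)]
  exact defectKernel_le hμ hx.1.le

end DefectKernel

/-! ### Increments of the defect convolution -/

section Weighted

variable {γ μ t h T B : ℝ} {f : ℝ → ℝ}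

lemma VWeighted_eq (hγ1 : γ < 1) (hμ : 0 < μ) (ht : 0 ≤ t) (hf : BddMeas f t B) :
    VWeighted γ μ t f = (Real.Gamma (1 - γ))⁻¹ *
      (posConv (abelKernel (1 - γ)) f t - posConv (defectKernel γ μ) f t) := by
  rw [VWeighted, posConv, posConv, ← intervalIntegral.integral_sub
    (intervalIntegrable_posConv ht le_rfl (intervalIntegrable_abelKernel (by linarith) ht) hf)
    (intervalIntegrable_posConv ht le_rfl (intervalIntegrable_defectKernel hμ ht) hf)]
  congr 1
  refine integral_congr fun τ _ => ?_
  simp only [defectKernel, abelKernel, smul_eq_mul, sub_sub_cancel]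
  ring

/-- A lower bound for the increments of the convolution with the defect kernel. -/
lemma le_posConv_defectKernel_sub (hγ0 : 0 < γ) (hγ1 : γ < 1) (hμ : 0 < μ) (hf : Continuous f)
    (hf0 : ∀ s ∈ Icc 0 T, 0 ≤ f s) (hB : ∀ s ∈ Icc 0 T, f s ≤ B)
    (ht : 0 ≤ t) (hh : 0 ≤ h) (hT : t + h ≤ T) :
    μ * ((∫ s in (0 : ℝ)..(t + h), f s) - ∫ s in (0 : ℝ)..t, f s) - μ ^ 2 * B * h ^ (1 + γ) -
        μ ^ 2 * h * posConv (abelKernel γ) f t ≤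
      posConv (defectKernel γ μ) f (t + h) - posConv (defectKernel γ μ) f t := by
  have hth : 0 ≤ t + h := by linarith
  have hfB : BddMeas f T B := BddMeas.of_continuousOn hf.continuousOn fun s hs => by
    rw [Real.norm_of_nonneg (hf0 s hs)]; exact hB s hs
  have hK := intervalIntegrable_defectKernel (γ := γ) hμ hth
  have i1 := intervalIntegrable_posConv hth hT hK hfB
  have i2 := intervalIntegrable_posConv ht (by linarith)
    (intervalIntegrable_defectKernel (γ := γ) hμ ht) hfB
  have i3 := intervalIntegrable_posConv ht (by linarith) (intervalIntegrable_abelKernel hγ0 ht) hfB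
  rw [posConv_sub ht hh hT hK hfB, integral_interval_sub_left (hf.intervalIntegrable _ _)
    (hf.intervalIntegrable _ _)]
  have e1 : μ * (∫ s in t..(t + h), f s) - μ ^ 2 * B * h ^ (1 + γ) ≤
      ∫ τ in t..(t + h), defectKernel γ μ (t + h - τ) • f τ := by
    have : ∫ τ in t..(t + h), (μ * f τ - μ ^ 2 * h ^ γ * B) ≤
        ∫ τ in t..(t + h), defectKernel γ μ (t + h - τ) • f τ := by
      rw [integral_of_le (by linarith), integral_of_le (by linarith), integral_Ioc_eq_integral_Ioo,
        integral_Ioc_eq_integral_Ioo]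
      refine setIntegral_mono_on ?_ ((intervalIntegrable_iff_integrableOn_Ioo_of_le
        (by linarith)).1 (intervalIntegrable_mono_left i1 ht (by linarith))) measurableSet_Ioo ?_
      · rw [← intervalIntegrable_iff_integrableOn_Ioo_of_le (by linarith)]
        exact Continuous.intervalIntegrable (by fun_prop) _ _
      intro τ hτ
      have hτm : τ ∈ Icc 0 T := ⟨by linarith [hτ.1], by linarith [hτ.2]⟩
      have h1 := le_defectKernel (γ := γ) hμ (sub_pos.2 hτ.2)
      have h2 : (t + h - τ) ^ γ ≤ h ^ γ :=
        Real.rpow_le_rpow (by linarith [hτ.2]) (by linarith [hτ.1]) hγ0.le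
      have h3 := hf0 τ hτm
      have h4 := hB τ hτm
      simp only [smul_eq_mul]
      calc μ * f τ - μ ^ 2 * h ^ γ * B ≤ μ * f τ - μ ^ 2 * h ^ γ * f τ := by gcongr
        _ ≤ μ * f τ - μ ^ 2 * (t + h - τ) ^ γ * f τ := by gcongr
        _ = (μ - μ ^ 2 * (t + h - τ) ^ γ) * f τ := by ring
        _ ≤ _ := mul_le_mul_of_nonneg_right h1 h3
    rw [intervalIntegral.integral_sub (Continuous.intervalIntegrable (by fun_prop) _ _)
      (Continuous.intervalIntegrable (by fun_prop) _ _), intervalIntegral.integral_const_mul] at this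
    refine le_trans (le_of_eq ?_) this
    rw [Real.rpow_add_of_nonneg hh zero_le_one hγ0.le]
    simp
    ring
  have e2 : -(μ ^ 2 * h * posConv (abelKernel γ) f t) ≤
      ∫ τ in (0 : ℝ)..t, (defectKernel γ μ (t + h - τ) - defectKernel γ μ (t - τ)) • f τ := by
    rw [posConv, ← intervalIntegral.integral_const_mul, ← intervalIntegral.integral_neg]
    have i4 : IntervalIntegrable (fun τ => (defectKernel γ μ (t + h - τ) -
        defectKernel γ μ (t - τ)) • f τ) volume 0 t := by
      simp only [sub_smul]
      exact (intervalIntegrable_mono_right i1 ht (by linarith)).sub i2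
    rw [integral_of_le ht, integral_of_le ht, integral_Ioc_eq_integral_Ioo,
      integral_Ioc_eq_integral_Ioo]
    refine setIntegral_mono_on
      ((intervalIntegrable_iff_integrableOn_Ioo_of_le ht).1 (i3.const_mul _).neg)
      ((intervalIntegrable_iff_integrableOn_Ioo_of_le ht).1 i4) measurableSet_Ioo ?_
    intro τ hτ
    have h1 := neg_le_of_abs_le (abs_defectKernel_sub_le hγ0.le hγ1.le hμ (sub_pos.2 hτ.2) hh)
    have h3 := hf0 τ ⟨hτ.1.le, by linarith [hτ.2]⟩
    simp only [smul_eq_mul]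
    rw [show t + h - τ = t - τ + h by ring]
    calc _ = (-(μ ^ 2 * h * abelKernel γ (t - τ))) * f τ := by ring
      _ ≤ _ := mul_le_mul_of_nonneg_right h1 h3
  linarith

/-- A cruder two-sided bound, enough for the Lipschitz property: the new interval costs the bound μ
of the kernel, the past its variation. -/
lemma abs_posConv_defectKernel_sub_le (hγ0 : 0 < γ) (hγ1 : γ < 1) (hμ : 0 < μ)
    (hB0 : 0 ≤ B) (hf : BddMeas f T B)
    (ht : 0 ≤ t) (hh : 0 ≤ h) (hT : t + h ≤ T) :
    |posConv (defectKernel γ μ) f (t + h) - posConv (defectKernel γ μ) f t| ≤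
      (μ * B + μ ^ 2 * B * T ^ γ / γ) * h := by
  have hth : 0 ≤ t + h := by linarith
  have hK := intervalIntegrable_defectKernel (γ := γ) hμ hth
  have hb := (ae_restrict_iff' measurableSet_Ioc).1 hf.bound
  rw [posConv_sub ht hh hT hK hf]
  have e1 : ‖∫ τ in t..(t + h), defectKernel γ μ (t + h - τ) • f τ‖ ≤ μ * B * h := by
    have : ‖∫ τ in t..(t + h), defectKernel γ μ (t + h - τ) • f τ‖ ≤
        ∫ τ in t..(t + h), μ * B := by
      refine norm_integral_le_of_norm_le (by linarith) ?_ (by simp)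
      filter_upwards [hb] with τ hτ hτ'
      have h0 : 0 ≤ t + h - τ := by linarith [hτ'.2]
      rw [norm_smul, Real.norm_of_nonneg (defectKernel_nonneg hμ.le h0)]
      exact mul_le_mul (defectKernel_le hμ h0) (hτ ⟨by linarith [hτ'.1], by linarith [hτ'.2]⟩)
        (norm_nonneg _) hμ.le
    refine this.trans_eq ?_
    simp
    ring
  have e2 : ‖∫ τ in (0 : ℝ)..t, (defectKernel γ μ (t + h - τ) - defectKernel γ μ (t - τ)) • f τ‖ ≤
      μ ^ 2 * B * T ^ γ / γ * h := by
    have : ‖∫ τ in (0 : ℝ)..t, (defectKernel γ μ (t + h - τ) - defectKernel γ μ (t - τ)) • f τ‖ ≤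
        ∫ τ in (0 : ℝ)..t, μ ^ 2 * h * B * abelKernel γ (t - τ) := by
      refine norm_integral_le_of_norm_le ht ?_
        ((intervalIntegrable_comp_sub (intervalIntegrable_abelKernel hγ0 ht)).const_mul _)
      have hne : ∀ᵐ τ : ℝ, τ ≠ t := by simp [ae_iff]
      filter_upwards [hb, hne] with τ hτ hne hτ'
      have hpos : 0 < t - τ := sub_pos.2 (lt_of_le_of_ne hτ'.2 hne)
      have h1 := abs_defectKernel_sub_le hγ0.le hγ1.le hμ hpos hh
      rw [norm_smul, Real.norm_eq_abs, show t + h - τ = t - τ + h by ring]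
      calc _ ≤ (μ ^ 2 * h * abelKernel γ (t - τ)) * B :=
            mul_le_mul h1 (hτ ⟨hτ'.1, by linarith [hτ'.2]⟩) (norm_nonneg _)
              ((abs_nonneg _).trans h1)
        _ = _ := by ring
    rw [intervalIntegral.integral_const_mul, integral_kernel_reflect,
      integral_abelKernel hγ0 ht] at this
    have h2 : t ^ γ ≤ T ^ γ := Real.rpow_le_rpow ht (by linarith) hγ0.le
    calc _ ≤ _ := this
      _ ≤ μ ^ 2 * h * B * (T ^ γ / γ) := by gcongr
      _ = _ := by ring
  rw [← Real.norm_eq_abs]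
  calc _ ≤ _ := norm_add_le _ _
    _ ≤ _ := add_le_add e1 e2
    _ = _ := by ring

end Weighted

/-! ### Joint continuity of convolutions -/

section ContinuousConv

/-- A convolution of a locally integrable kernel with a jointly continuous family is jointly
continuous, up to its irrelevant values at negative times. -/
lemma exists_continuous_posConv {X : Type*} [TopologicalSpace X] [FirstCountableTopology X]
    {K : ℝ → ℝ} (hKm : Measurable K) (hK0 : ∀ s, 0 < s → 0 ≤ K s)
    (hK : ∀ t, 0 ≤ t → IntervalIntegrable K volume 0 t)
    {f : X → ℝ → ℝ} (hf : Continuous (Function.uncurry f)) :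
    ∃ g : X → ℝ → ℝ, Continuous (Function.uncurry g) ∧
      ∀ x t, 0 ≤ t → g x t = posConv K (f x) t := by
  -- The kernel, cut to s > 0, becomes the density of a locally finite atomless measure, so the
  -- convolution is a parametric integral of a continuous function.
  let k : ℝ → NNReal := fun s => (Ioi (0 : ℝ)).indicator (fun s => (K s).toNNReal) s
  have hkm : Measurable k := (hKm.real_toNNReal).indicator measurableSet_Ioi
  let ν : Measure ℝ := volume.withDensity fun s => (k s : ENNReal)
  have hk : ∀ s, 0 < s → (k s : ℝ) = K s := fun s hs => by
    simp [k, hs, hK0 s hs]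
  have hν : ∀ n : ℝ, 0 ≤ n → ν (Ioc (-n) n) < ⊤ := by
    intro n hn
    rw [withDensity_apply _ measurableSet_Ioc]
    have h1 : IntegrableOn (fun s => (k s : ℝ)) (Ioc (-n) n) := by
      have h2 : IntegrableOn K (Ioc 0 n) :=
        (intervalIntegrable_iff_integrableOn_Ioc_of_le hn).1 (hK n hn)
      have h3 : (fun s => (k s : ℝ)) = (Ioi (0 : ℝ)).indicator K := by
        ext s
        by_cases hs : 0 < s
        · rw [hk s hs, indicator_of_mem (mem_Ioi.2 hs)]
        · simp [k, hs]
      rw [h3, IntegrableOn, integrable_indicator_iff measurableSet_Ioi, IntegrableOn,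
        Measure.restrict_restrict measurableSet_Ioi]
      refine h2.mono_set ?_
      rintro x ⟨hx, -, hx'⟩
      exact ⟨hx, hx'⟩
    have := h1.2
    simpa [HasFiniteIntegral] using this
  have hlf : IsLocallyFiniteMeasure ν := by
    refine ⟨fun x => ⟨Ioc (-(|x| + 1)) (|x| + 1), Ioc_mem_nhds ?_ ?_, hν _ (by positivity)⟩⟩
    · linarith [neg_abs_le x]
    · linarith [le_abs_self x]
  have hna : NullSingletonClass ν :=
    ⟨fun x => withDensity_absolutelyContinuous _ _ (by simp)⟩
  refine ⟨fun x t => ∫ s in (0 : ℝ)..t, f x (t - s) ∂ν, ?_, ?_⟩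
  · exact continuous_parametric_intervalIntegral_of_continuous (X := X × ℝ)
      (f := fun p s => f p.1 (p.2 - s))
      (hf.comp (g := Function.uncurry f) (f := fun q : (X × ℝ) × ℝ => (q.1.1, q.1.2 - q.2))
        (by fun_prop)) continuous_snd
  · intro x t ht
    have h1 : posConv K (f x) t = ∫ s in (0 : ℝ)..t, K s • f x (t - s) := by
      rw [posConv]
      have := integral_comp_sub_left (fun s => K s • f x (t - s)) t (a := 0) (b := t)
      simpa using this
    simp only
    rw [h1, integral_of_le ht, integral_of_le ht, setIntegral_withDensity_eq_setIntegral_smul hkm _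
      measurableSet_Ioc]
    refine setIntegral_congr_fun measurableSet_Ioc fun s hs => ?_
    simp only [NNReal.smul_def, hk s hs.1]

lemma exists_continuous_fracInt {X : Type*} [TopologicalSpace X] [FirstCountableTopology X]
    {b : ℝ} (hb : 0 ≤ b) {f : X → ℝ → ℝ} (hf : Continuous (Function.uncurry f)) :
    ∃ g : X → ℝ → ℝ, Continuous (Function.uncurry g) ∧
      ∀ x t, 0 ≤ t → g x t = fracInt b (f x) t := by
  rcases hb.eq_or_lt with rfl | hb
  · exact ⟨f, hf, fun x t _ => by rw [fracInt_zero]⟩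
  · obtain ⟨g, hg, hg'⟩ := exists_continuous_posConv measurable_abelKernel
      (fun s hs => abelKernel_nonneg hs.le)
      (fun t ht => intervalIntegrable_abelKernel hb ht) hf
    refine ⟨fun x t => (Real.Gamma b)⁻¹ * g x t, hg.const_mul _, fun x t ht => ?_⟩
    simp only
    rw [fracInt_of_ne_zero hb.ne', hg' x t ht, smul_eq_mul]

lemma VWeighted_congr {γ μ t : ℝ} {f g : ℝ → ℝ} (ht : 0 ≤ t) (h : ∀ s ∈ Icc 0 t, f s = g s) :
    VWeighted γ μ t f = VWeighted γ μ t g := by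
  unfold VWeighted
  congr 1
  refine integral_congr fun s hs => ?_
  rw [uIcc_of_le ht] at hs
  simp only [h s hs]

lemma VWeighted_eq_posConv {γ μ t : ℝ} {f : ℝ → ℝ} :
    VWeighted γ μ t f = (Real.Gamma (1 - γ))⁻¹ *
      posConv (fun s => Real.exp (-μ * s ^ γ) * abelKernel (1 - γ) s) f t := by
  unfold VWeighted posConv
  congr 1
  refine integral_congr fun s _ => ?_
  simp only [abelKernel, sub_sub_cancel, smul_eq_mul]
  ring

lemma exp_mul_abelKernel_le {a γ μ s : ℝ} (hμ : 0 ≤ μ) (hs : 0 ≤ s) :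
    Real.exp (-μ * s ^ γ) * abelKernel a s ≤ abelKernel a s := by
  refine mul_le_of_le_one_left (abelKernel_nonneg hs) (Real.exp_le_one_iff.2 ?_)
  have : 0 ≤ s ^ γ := Real.rpow_nonneg hs _
  nlinarith

lemma intervalIntegrable_weightedKernel {a γ μ t : ℝ} (ha : 0 < a) (hμ : 0 ≤ μ) (ht : 0 ≤ t) :
    IntervalIntegrable (fun s => Real.exp (-μ * s ^ γ) * abelKernel a s) volume 0 t := by
  have hm : Measurable fun s => Real.exp (-μ * s ^ γ) * abelKernel a s := by
    have := measurable_abelKernel (a := a)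
    fun_prop
  refine (intervalIntegrable_abelKernel ha ht).mono_fun hm.aestronglyMeasurable ?_
  rw [uIoc_of_le ht]
  filter_upwards [ae_restrict_mem measurableSet_Ioc] with s hs
  have h0 := abelKernel_nonneg (a := a) hs.1.le
  rw [Real.norm_of_nonneg (by positivity), Real.norm_of_nonneg h0]
  exact exp_mul_abelKernel_le hμ hs.1.le

end ContinuousConv

/-! ### Continuity on the space of paths -/

namespace G

variable {n : ℕ} {T : ℝ}

/-- The endpoint of one graph lies within `dist p q` of a point of the other, whose time cannot
exceed the other's final time. -/
lemma abs_time_sub_le (p q : G n T) : |(p.time : ℝ) - q.time| ≤ dist p q := by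
  have key : ∀ p q : G n T, (p.time : ℝ) - q.time ≤ dist p q := by
    intro p q
    obtain ⟨s, hs⟩ := ((dist_le_iff p q _).1 le_rfl).1 ⟨p.time, p.time_nonneg, le_rfl⟩
    have h1 : |(p.time : ℝ) - s| ≤ dist p q := by
      refine le_trans ?_ hs
      unfold ptDist
      exact Real.le_sqrt_of_sq_le (by simp only [le_add_iff_nonneg_right]; positivity)
    linarith [le_abs_self ((p.time : ℝ) - s), s.2.2]
  rw [abs_le]
  constructor
  · have := key q p
    rw [dist_comm] at this
    linarith
  · exact key p q

lemma continuous_time : Continuous fun p : G n T => (p.time : ℝ) := by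
  rw [Metric.continuous_iff]
  intro p ε hε
  refine ⟨ε, hε, fun q hq => ?_⟩
  rw [Real.dist_eq]
  exact (abs_time_sub_le q p).trans_lt hq

lemma ext_eq (p : G n T) (x : ℝ) : p.ext x = p.path (projIcc 0 (p.time : ℝ) p.time_nonneg x) := rfl

lemma ext_of_mem (p : G n T) {x : ℝ} (hx : x ∈ Icc 0 (p.time : ℝ)) : p.ext x = p.path ⟨x, hx⟩ :=
  IccExtend_of_mem _ _ hx

lemma continuous_ext (p : G n T) : Continuous p.ext := p.path.continuous.Icc_extend'

lemma ext_zero (p : G n T) : p.ext 0 = p.init := p.ext_of_mem ⟨le_rfl, p.time_nonneg⟩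

lemma ext_max_min (p : G n T) (x : ℝ) : p.ext (max 0 (min p.time x)) = p.ext x := by
  rw [ext_eq, ext_eq]
  congr 1
  apply Subtype.ext
  simp only [coe_projIcc]
  have := p.time_nonneg
  rcases le_total (p.time : ℝ) x with h | h <;> rcases le_total 0 x with h' | h' <;> simp [*]

/-- The evaluation of extended paths is jointly continuous. -/
lemma continuous_uncurry_ext : Continuous fun z : G n T × ℝ => z.1.ext z.2 := by
  rw [continuous_iff_continuousAt]
  rintro ⟨p, x⟩
  -- Clamping the time to the domain keeps the extended value; the Hausdorff distance then supplies
  -- a nearby point of the graph of `p`. As z tends to (p, x), its time s tends to the clamped x.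
  have hclose : ∀ z : G n T × ℝ, ∃ s : ℝ, |max 0 (min (z.1.time : ℝ) z.2) - s| ≤ dist z.1 p ∧
      dist (z.1.ext z.2) (p.ext s) ≤ dist z.1 p := by
    rintro ⟨q, y⟩
    have hy : max 0 (min (q.time : ℝ) y) ∈ Icc 0 (q.time : ℝ) :=
      ⟨le_max_left _ _, max_le q.time_nonneg (min_le_left _ _)⟩
    obtain ⟨s, hs⟩ := ((dist_le_iff q p _).1 le_rfl).1 ⟨_, hy⟩
    unfold ptDist at hs
    refine ⟨s, le_trans ?_ hs, le_trans ?_ hs⟩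
    · exact Real.le_sqrt_of_sq_le (by simp only [le_add_iff_nonneg_right]; positivity)
    · rw [← ext_max_min, q.ext_of_mem hy, p.ext_of_mem s.2, dist_eq_norm]
      exact Real.le_sqrt_of_sq_le (by simp only [le_add_iff_nonneg_left]; positivity)
  choose s hs1 hs2 using hclose
  have hd : Tendsto (fun z : G n T × ℝ => dist z.1 p) (𝓝 (p, x)) (𝓝 0) := by
    have : Continuous fun z : G n T × ℝ => dist z.1 p := by fun_prop
    simpa using this.tendsto (p, x)
  have hσ : Tendsto (fun z : G n T × ℝ => max 0 (min (z.1.time : ℝ) z.2)) (𝓝 (p, x))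
      (𝓝 (max 0 (min (p.time : ℝ) x))) := by
    have h := (continuous_time (n := n) (T := T)).comp (continuous_fst (Y := ℝ))
    have : Continuous fun z : G n T × ℝ => max 0 (min (z.1.time : ℝ) z.2) :=
      continuous_const.max (h.min continuous_snd)
    exact this.tendsto (p, x)
  have hs : Tendsto s (𝓝 (p, x)) (𝓝 (max 0 (min (p.time : ℝ) x))) := by
    have h0 : Tendsto (fun z => max 0 (min (z.1.time : ℝ) z.2) - s z) (𝓝 (p, x)) (𝓝 0) :=
      squeeze_zero_norm hs1 hd
    simpa using hσ.sub h0
  have h1 : Tendsto (fun z => p.ext (s z)) (𝓝 (p, x)) (𝓝 (p.ext x)) := by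
    have := (p.continuous_ext.tendsto _).comp hs
    rwa [ext_max_min] at this
  exact (tendsto_iff_of_dist (squeeze_zero (fun _ => dist_nonneg) hs2 hd)).2 h1

end G

/-- Joint continuity passes through both convolutions, of order β and then with the weighted kernel,
starting from evaluation. -/
lemma continuous_VStar {n : ℕ} {T α β μ : ℝ} (hβ : 0 ≤ β) (h1 : α + β < 1) (hμ : 0 ≤ μ) :
    Continuous (VStar α β μ : G n T → ℝ) := by
  have hr : Continuous (Function.uncurry fun (p : G n T) ξ => ‖p.ext ξ - p.init‖ ^ 2) := by
    have h1 : Continuous fun z : G n T × ℝ => z.1.ext z.2 := G.continuous_uncurry_ext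
    have h2 : Continuous fun z : G n T × ℝ => z.1.init := by
      simp only [← G.ext_zero]
      exact h1.comp (continuous_fst.prodMk continuous_const)
    exact ((h1.sub h2).norm).pow 2
  obtain ⟨g, hg, hg'⟩ := exists_continuous_fracInt hβ hr
  have hm : Measurable fun s => Real.exp (-μ * s ^ (α + β)) * abelKernel (1 - (α + β)) s := by
    have := measurable_abelKernel (a := 1 - (α + β))
    fun_prop
  obtain ⟨G', hG, hG'⟩ := exists_continuous_posConv hm
    (fun s hs => mul_nonneg (Real.exp_nonneg _) (abelKernel_nonneg hs.le))
    (fun t ht => intervalIntegrable_weightedKernel (by linarith) hμ ht) hg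
  have : (VStar α β μ : G n T → ℝ) =
      fun p => (Real.Gamma (1 - (α + β)))⁻¹ * G' p p.time := by
    ext p
    rw [hG' p _ p.time_nonneg, VStar, ← VWeighted_eq_posConv]
    exact VWeighted_congr p.time_nonneg fun s hs => (hg' p s hs.1).symm
  rw [this]
  exact continuous_const.mul (hG.comp (continuous_id.prodMk G.continuous_time))

/-! ### Positivity and comparison of fractional integrals -/

section Order

variable {a b c t T μ γ : ℝ} {f : ℝ → ℝ}

lemma fracInt_nonneg (hb : 0 ≤ b) (ht : 0 ≤ t) (hf : ∀ s ∈ Icc 0 t, 0 ≤ f s) :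
    0 ≤ fracInt b f t := by
  rcases hb.eq_or_lt with rfl | hb
  · rw [fracInt_zero]
    exact hf t ⟨ht, le_rfl⟩
  · rw [fracInt_of_ne_zero hb.ne']
    refine smul_nonneg (inv_nonneg.2 (Real.Gamma_pos_of_pos hb).le) ?_
    exact intervalIntegral.integral_nonneg ht fun s hs =>
      smul_nonneg (abelKernel_nonneg (by linarith [hs.2])) (hf s hs)

lemma fracInt_eq_zero (ht : 0 ≤ t) (hf : ∀ s ∈ Icc 0 t, f s = 0) : fracInt b f t = 0 := by
  rw [fracInt_congr (g := 0) ht hf]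
  by_cases hb : b = 0
  · simp [fracInt, hb]
  · simp [fracInt, hb]

lemma VWeighted_nonneg (hγ : γ < 1) (ht : 0 ≤ t) (hf : ∀ s ∈ Icc 0 t, 0 ≤ f s) :
    0 ≤ VWeighted γ μ t f := by
  refine mul_nonneg (inv_nonneg.2 (Real.Gamma_pos_of_pos (by linarith)).le) ?_
  refine intervalIntegral.integral_nonneg ht fun s hs => ?_
  exact div_nonneg (mul_nonneg (Real.exp_nonneg _) (hf s hs))
    (Real.rpow_nonneg (by linarith [hs.2]) _)

/-- On [0, T] the exponential weight is bounded below by its value at T. -/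
lemma exp_mul_fracInt_le_VWeighted {B : ℝ} (hγ0 : 0 ≤ γ) (hγ1 : γ < 1) (hμ : 0 ≤ μ) (ht : 0 ≤ t)
    (htT : t ≤ T) (hfB : BddMeas f t B) (hf : ∀ s ∈ Icc 0 t, 0 ≤ f s) :
    Real.exp (-μ * T ^ γ) * fracInt (1 - γ) f t ≤ VWeighted γ μ t f := by
  have hγ' : 0 < 1 - γ := by linarith
  rw [VWeighted_eq_posConv, fracInt_of_ne_zero hγ'.ne', smul_eq_mul, mul_left_comm]
  refine mul_le_mul_of_nonneg_left ?_ (inv_nonneg.2 (Real.Gamma_pos_of_pos hγ').le)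
  rw [posConv, posConv, ← intervalIntegral.integral_const_mul]
  refine integral_mono_on ht
    ((intervalIntegrable_posConv ht le_rfl (intervalIntegrable_abelKernel hγ' ht) hfB).const_mul _)
    (intervalIntegrable_posConv ht le_rfl (intervalIntegrable_weightedKernel hγ' hμ ht) hfB) ?_
  intro s hs
  have h0 : 0 ≤ t - s := by linarith [hs.2]
  simp only [smul_eq_mul]
  rw [← mul_assoc]
  refine mul_le_mul_of_nonneg_right (mul_le_mul_of_nonneg_right ?_ (abelKernel_nonneg h0)) (hf s hs)
  refine Real.exp_le_exp.2 ?_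
  have : (t - s) ^ γ ≤ T ^ γ := Real.rpow_le_rpow h0 (by linarith [hs.1]) hγ0
  nlinarith

/-- The higher-order kernel is the lower-order one times (t - s)^{b-a} ≤ T^{b-a}, up to Gamma
factors. -/
lemma fracInt_le_mul_fracInt {B : ℝ} (ha : 0 < a) (hab : a ≤ b) (ht : 0 ≤ t) (htT : t ≤ T)
    (hfB : BddMeas f t B) (hf : ∀ s ∈ Icc 0 t, 0 ≤ f s) :
    fracInt b f t ≤ T ^ (b - a) * Real.Gamma a / Real.Gamma b * fracInt a f t := by
  have hb : 0 < b := by linarith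
  have hGa := Real.Gamma_pos_of_pos ha
  have hGb := Real.Gamma_pos_of_pos hb
  have key : posConv (abelKernel b) f t ≤ T ^ (b - a) * posConv (abelKernel a) f t := by
    rw [posConv, posConv, ← intervalIntegral.integral_const_mul, integral_of_le ht,
      integral_of_le ht, integral_Ioc_eq_integral_Ioo, integral_Ioc_eq_integral_Ioo]
    refine setIntegral_mono_on
      ((intervalIntegrable_iff_integrableOn_Ioo_of_le ht).1
        (intervalIntegrable_posConv ht le_rfl (intervalIntegrable_abelKernel hb ht) hfB))
      ((intervalIntegrable_iff_integrableOn_Ioo_of_le ht).1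
        ((intervalIntegrable_posConv ht le_rfl
          (intervalIntegrable_abelKernel ha ht) hfB).const_mul _)) measurableSet_Ioo ?_
    intro s hs
    have h0 : 0 < t - s := sub_pos.2 hs.2
    simp only [smul_eq_mul]
    rw [← mul_assoc]
    refine mul_le_mul_of_nonneg_right ?_ (hf s ⟨hs.1.le, hs.2.le⟩)
    rw [abelKernel_eq_rpow h0.le, abelKernel_eq_rpow h0.le,
      show b - 1 = (b - a) + (a - 1) by ring, Real.rpow_add h0]
    gcongr
    linarith [hs.1]
  rw [fracInt_of_ne_zero ha.ne', fracInt_of_ne_zero hb.ne', smul_eq_mul, smul_eq_mul]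
  calc _ ≤ (Real.Gamma b)⁻¹ * (T ^ (b - a) * posConv (abelKernel a) f t) := by gcongr
    _ = _ := by field_simp

/-- If the weighted integral of a continuous nonnegative function vanishes, so does the function. -/
lemma eq_zero_of_VWeighted_eq_zero (hγ : γ < 1) (hμ : 0 ≤ μ) (hT : 0 < T)
    (hfc : Continuous f) (hf : ∀ s ∈ Icc 0 T, 0 ≤ f s) (h : VWeighted γ μ T f = 0) :
    ∀ s ∈ Icc 0 T, f s = 0 := by
  have hγ' : 0 < 1 - γ := by linarith
  obtain ⟨B, hB⟩ := isCompact_Icc.exists_bound_of_continuousOn (hfc.continuousOn (s := Icc 0 T))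
  have hI := intervalIntegrable_posConv hT.le le_rfl
    (intervalIntegrable_weightedKernel (γ := γ) hγ' hμ hT.le)
    (BddMeas.of_continuousOn hfc.continuousOn hB)
  rw [intervalIntegrable_iff_integrableOn_Ioo_of_le hT.le] at hI
  rw [VWeighted_eq_posConv, mul_eq_zero, or_iff_right
    (inv_ne_zero (Real.Gamma_pos_of_pos hγ').ne'), posConv, integral_of_le hT.le,
    integral_Ioc_eq_integral_Ioo, setIntegral_eq_zero_iff_of_nonneg_ae ?_ hI] at h
  · have h1 : f =ᵐ[volume.restrict (Ioo 0 T)] fun _ => 0 := by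
      filter_upwards [h, ae_restrict_mem measurableSet_Ioo] with s hs hs'
      have hk := abelKernel_pos (a := 1 - γ) (sub_pos.2 hs'.2)
      have : Real.exp (-μ * (T - s) ^ γ) * abelKernel (1 - γ) (T - s) ≠ 0 := by positivity
      exact (mul_eq_zero.1 hs).resolve_left this
    have h2 : f =ᵐ[volume.restrict (Icc 0 T)] fun _ => 0 := by
      rwa [restrict_Ioo_eq_restrict_Icc] at h1
    exact Measure.eqOn_Icc_of_ae_eq volume hT.ne h2 hfc.continuousOn continuousOn_const
  · filter_upwards [ae_restrict_mem measurableSet_Ioo] with s hs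
    exact mul_nonneg (mul_nonneg (Real.exp_nonneg _)
      (abelKernel_nonneg (sub_pos.2 hs.2).le)) (hf s ⟨hs.1.le, hs.2.le⟩)

end Order

/-! ### Splitting the weighted functional -/

section NormSq

variable {F : Type*} [NormedAddCommGroup F] {Y : ℝ → F} {α β μ : ℝ}

lemma exists_continuous_eq_fracInt (hβ : 0 ≤ β) (hY : Continuous Y) :
    ∃ f : ℝ → ℝ, Continuous f ∧ ∀ t, 0 ≤ t → f t = fracInt β (fun ξ => ‖Y ξ‖ ^ 2) t := by
  obtain ⟨g, hg, hg'⟩ := exists_continuous_fracInt (X := Unit) hβ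
    (f := fun _ ξ => ‖Y ξ‖ ^ 2) (by fun_prop)
  exact ⟨g (), hg.comp (by fun_prop : Continuous fun t : ℝ => ((), t)), fun t ht => hg' () t ht⟩

lemma bddMeas_norm_sq (hY : Continuous Y) (T : ℝ) : ∃ B, BddMeas (fun ξ => ‖Y ξ‖ ^ 2) T B := by
  have hr : ContinuousOn (fun ξ => ‖Y ξ‖ ^ 2) (Icc 0 T) := by fun_prop
  obtain ⟨B, hB⟩ := isCompact_Icc.exists_bound_of_continuousOn hr
  exact ⟨B, BddMeas.of_continuousOn hr hB⟩

/-- Since (1 - γ) + β = 1 - α, the semigroup law frees the Abel part of β; only the defect term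
depends on β and μ. -/
lemma VWeighted_fracInt_eq (hβ : 0 ≤ β) (hαβ : α + β < 1) (hμ : 0 < μ)
    (hY : Continuous Y) {f : ℝ → ℝ} (hfc : Continuous f)
    (hf : ∀ t, 0 ≤ t → f t = fracInt β (fun ξ => ‖Y ξ‖ ^ 2) t) {t : ℝ} (ht : 0 ≤ t) :
    VWeighted (α + β) μ t (fracInt β fun ξ => ‖Y ξ‖ ^ 2) =
      (Real.Gamma (1 - α))⁻¹ * posConv (abelKernel (1 - α)) (fun ξ => ‖Y ξ‖ ^ 2) t -
        (Real.Gamma (1 - (α + β)))⁻¹ * posConv (defectKernel (α + β) μ) f t := by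
  obtain ⟨B, hB⟩ := isCompact_Icc.exists_bound_of_continuousOn (hfc.continuousOn (s := Icc 0 t))
  obtain ⟨B', hB'⟩ := bddMeas_norm_sq hY t
  have h1 : (1 : ℝ) - (α + β) ≠ 0 := by linarith
  have h2 : (1 : ℝ) - α ≠ 0 := by linarith
  rw [← VWeighted_congr ht fun s hs => hf s hs.1,
    VWeighted_eq hαβ hμ ht (BddMeas.of_continuousOn hfc.continuousOn hB), mul_sub]
  congr 1
  have := fracInt_fracInt (a := 1 - (α + β)) (by linarith) hβ ht hB'
  rw [← fracInt_congr ht fun s hs => hf s hs.1, show 1 - (α + β) + β = 1 - α by ring,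
    fracInt_of_ne_zero h1, fracInt_of_ne_zero h2] at this
  exact this

end NormSq

/-! ### Lipschitz bound and differential inequality for one functional -/

section Derivative

lemma inner_increment {F : Type*} [NormedAddCommGroup F] [InnerProductSpace ℝ F] {Y : ℝ → F}
    {α : ℝ} (hα1 : α < 1) (t δ : ℝ) :
    (Real.Gamma (1 - α))⁻¹ * (2 * inner ℝ (Y t) (posConv (abelKernel (1 - α)) Y (t + δ) -
          posConv (abelKernel (1 - α)) Y t)) =
      2 * inner ℝ (Y t) (fracInt (1 - α) Y (t + δ) - fracInt (1 - α) Y t) := by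
  have h2 : (1 : ℝ) - α ≠ 0 := by linarith
  rw [fracInt_of_ne_zero h2, fracInt_of_ne_zero h2, ← smul_sub, inner_smul_right]
  ring


/-- Once differentiability is known, right increments alone determine the derivative, so one-sided
estimates suffice. -/
lemma deriv_le_of_increment_le {v g : ℝ → ℝ} {t g' : ℝ} (hv : DifferentiableAt ℝ v t)
    (hg : HasDerivAt g g' 0) (h : ∀ᶠ δ in 𝓝[>] 0, v (t + δ) - v t ≤ g δ - g 0) :
    deriv v t ≤ g' := by
  have h1 := hv.hasDerivAt.tendsto_slope_zero_right
  have h2 := hg.tendsto_slope_zero_right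
  refine le_of_tendsto_of_tendsto h1 h2 ?_
  filter_upwards [h, self_mem_nhdsWithin] with δ hδ hpos
  rw [zero_add]
  exact mul_le_mul_of_nonneg_left hδ (inv_nonneg.2 (le_of_lt hpos))

lemma lipschitzOnWith_of_increment_le {F : Type*} [NormedAddCommGroup F] {g : ℝ → F} {T L : ℝ}
    (hL : 0 ≤ L)
    (h : ∀ t δ, 0 ≤ t → 0 ≤ δ → t + δ ≤ T → ‖g (t + δ) - g t‖ ≤ L * δ) :
    LipschitzOnWith L.toNNReal g (Icc 0 T) := by
  have key : ∀ s ∈ Icc 0 T, ∀ t ∈ Icc 0 T, s ≤ t → dist (g t) (g s) ≤ L * dist t s := by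
    intro s hs t ht hst
    have := h s (t - s) hs.1 (sub_nonneg.2 hst) (by linarith [ht.2])
    rwa [add_sub_cancel, ← dist_eq_norm, ← abs_of_nonneg (sub_nonneg.2 hst), ← Real.dist_eq] at this
  refine LipschitzOnWith.of_dist_le_mul fun t ht s hs => ?_
  rw [Real.coe_toNNReal _ hL]
  rcases le_total s t with hst | hst
  · exact key s hs t ht hst
  · rw [dist_comm, dist_comm t]
    exact key t ht s hs hst

variable {F : Type*} [NormedAddCommGroup F] [InnerProductSpace ℝ F] [CompleteSpace F]
  {Y : ℝ → F} {α β μ H L T : ℝ}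

/-- A Hölder path issuing from the origin whose Caputo derivative is bounded. -/
structure FracLip (α T H L : ℝ) (Y : ℝ → F) : Prop where
  cont : Continuous Y
  zero : Y 0 = 0
  nonneg_hoelder : 0 ≤ H
  nonneg_lip : 0 ≤ L
  hoelder : ∀ s ∈ Icc 0 T, ∀ t ∈ Icc 0 T, ‖Y t - Y s‖ ≤ H * |t - s| ^ α
  lip : ∀ t δ, 0 ≤ t → 0 ≤ δ → t + δ ≤ T →
    ‖fracInt (1 - α) Y (t + δ) - fracInt (1 - α) Y t‖ ≤ L * δ

/-- Along a path with bounded Caputo derivative the weighted functional is Lipschitz. -/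
lemma FracLip.exists_increment_le (hY : FracLip α T H L Y) (hα0 : 0 < α) (hβ : 0 ≤ β)
    (hαβ : α + β < 1) (hμ : 0 < μ) (hT : 0 ≤ T) :
    ∃ C, 0 ≤ C ∧ ∀ t δ, 0 ≤ t → 0 ≤ δ → t + δ ≤ T →
      |VWeighted (α + β) μ (t + δ) (fracInt β fun ξ => ‖Y ξ‖ ^ 2) -
        VWeighted (α + β) μ t (fracInt β fun ξ => ‖Y ξ‖ ^ 2)| ≤ C * δ := by
  obtain ⟨f, hfc, hf⟩ := exists_continuous_eq_fracInt hβ hY.cont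
  obtain ⟨B, hB⟩ := isCompact_Icc.exists_bound_of_continuousOn (hfc.continuousOn (s := Icc 0 T))
  have hB0 : 0 ≤ B := (norm_nonneg _).trans (hB 0 ⟨le_rfl, hT⟩)
  obtain ⟨D, hD⟩ := isCompact_Icc.exists_bound_of_continuousOn
    (hY.cont.continuousOn (s := Icc 0 T))
  have hD0 : 0 ≤ D := (norm_nonneg _).trans (hD 0 ⟨le_rfl, hT⟩)
  have hα1 : α < 1 := by linarith
  have hc1 : 0 ≤ (Real.Gamma (1 - α))⁻¹ := inv_nonneg.2 (Real.Gamma_pos_of_pos (by linarith)).le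
  have hc2 : 0 ≤ (Real.Gamma (1 - (α + β)))⁻¹ :=
    inv_nonneg.2 (Real.Gamma_pos_of_pos (by linarith)).le
  set c1 := (Real.Gamma (1 - α))⁻¹ with hc1d
  set c2 := (Real.Gamma (1 - (α + β)))⁻¹ with hc2d
  set W := μ * B + μ ^ 2 * B * T ^ (α + β) / (α + β) with hW
  have hW0 : 0 ≤ W := by positivity
  have hp1 : 0 < 1 - α := by linarith
  set U := H ^ 2 / (1 - α) * T ^ α with hU
  set U' := H ^ 2 * T ^ α * (1 / α + 1 / (1 - α)) with hU'
  have hH := hY.nonneg_hoelder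
  have hU0 : 0 ≤ U := by positivity
  have hU0' : 0 ≤ U' := by positivity
  have hL := hY.nonneg_lip
  -- The inner-product increment, the upper and the lower error of the quadratic comparison, and the
  -- defect.
  refine ⟨2 * D * L + c1 * U + c1 * U' + c2 * W, by positivity, fun t δ ht hδ htδ => ?_⟩
  have htm : t ∈ Icc 0 T := ⟨ht, by linarith⟩
  rw [VWeighted_fracInt_eq hβ hαβ hμ hY.cont hfc hf (by linarith),
    VWeighted_fracInt_eq hβ hαβ hμ hY.cont hfc hf ht]
  have e1 := posConv_norm_sq_increment_le hα0 hα1 hY.cont.continuousOn hH hY.hoelder ht hδ htδ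
  have e2 := le_posConv_norm_sq_increment hα0 hα1 hY.cont.continuousOn hY.zero hY.hoelder ht hδ htδ
  have e3 := abs_le.1 (abs_posConv_defectKernel_sub_le (γ := α + β) (by linarith) hαβ hμ hB0
    (BddMeas.of_continuousOn hfc.continuousOn hB) ht hδ htδ)
  have e4 : |2 * inner ℝ (Y t) (fracInt (1 - α) Y (t + δ) - fracInt (1 - α) Y t)| ≤
      2 * D * L * δ := by
    rw [abs_mul, abs_two, mul_assoc, mul_assoc]
    refine mul_le_mul_of_nonneg_left ((abs_real_inner_le_norm _ _).trans ?_) zero_le_two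
    exact mul_le_mul (hD t htm) (hY.lip t δ ht hδ htδ) (norm_nonneg _) hD0
  rw [← inner_increment hα1, ← hc1d] at e4
  have e4' := abs_le.1 e4
  have e5 : δ ^ (1 + α) ≤ T ^ α * δ := by
    rw [Real.rpow_add_of_nonneg hδ zero_le_one hα0.le, Real.rpow_one, mul_comm]
    gcongr
    linarith
  have e6 : H ^ 2 / (1 - α) * δ ^ (1 + α) ≤ U * δ := by
    calc _ ≤ H ^ 2 / (1 - α) * (T ^ α * δ) := by gcongr
      _ = _ := by rw [hU]; ring
  have e7 := mul_le_mul_of_nonneg_left (e1.trans (add_le_add_right e6 _)) hc1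
  have e8 := mul_le_mul_of_nonneg_left e2 hc1
  have e9 := mul_le_mul_of_nonneg_left e3.1 hc2
  have e10 := mul_le_mul_of_nonneg_left e3.2 hc2
  have p1 : 0 ≤ c1 * U * δ := by positivity
  have p2 : 0 ≤ c1 * U' * δ := by positivity
  rw [abs_le]
  constructor <;> linarith

/-- The differential inequality for a single weighted functional. -/
lemma FracLip.deriv_VWeighted_le (hY : FracLip α T H L Y) (hα0 : 0 < α) (hβ : 0 ≤ β)
    (hαβ : α + β < 1) (hμ : 0 < μ) {t : ℝ} (ht : t ∈ Ioo 0 T)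
    (hv : DifferentiableAt ℝ
      (fun t => VWeighted (α + β) μ t (fracInt β fun ξ => ‖Y ξ‖ ^ 2)) t)
    (hP : DifferentiableAt ℝ (fracInt (1 - α) Y) t) :
    deriv (fun t => VWeighted (α + β) μ t (fracInt β fun ξ => ‖Y ξ‖ ^ 2)) t ≤
      2 * inner ℝ (Y t) (deriv (fracInt (1 - α) Y) t) -
        (Real.Gamma (1 - (α + β)))⁻¹ * μ * fracInt β (fun ξ => ‖Y ξ‖ ^ 2) t +
        (Real.Gamma (1 - (α + β)))⁻¹ * Real.Gamma (α + β) * μ ^ 2 *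
          fracInt (α + 2 * β) (fun ξ => ‖Y ξ‖ ^ 2) t := by
  obtain ⟨f, hfc, hf⟩ := exists_continuous_eq_fracInt hβ hY.cont
  obtain ⟨B, hB⟩ := isCompact_Icc.exists_bound_of_continuousOn (hfc.continuousOn (s := Icc 0 T))
  have hα1 : α < 1 := by linarith
  have hγ : 0 < α + β := by linarith
  have hc1 : 0 ≤ (Real.Gamma (1 - α))⁻¹ := inv_nonneg.2 (Real.Gamma_pos_of_pos (by linarith)).le
  have hc2 : 0 ≤ (Real.Gamma (1 - (α + β)))⁻¹ :=
    inv_nonneg.2 (Real.Gamma_pos_of_pos (by linarith)).le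
  set c1 := (Real.Gamma (1 - α))⁻¹ with hc1d
  set c2 := (Real.Gamma (1 - (α + β)))⁻¹ with hc2d
  have hf0 : ∀ s ∈ Icc 0 T, 0 ≤ f s := fun s hs => by
    rw [hf s hs.1]
    exact fracInt_nonneg hβ hs.1 fun _ _ => by positivity
  have hfB : ∀ s ∈ Icc 0 T, f s ≤ B := fun s hs => (le_abs_self _).trans (hB s hs)
  have hJ : posConv (abelKernel (α + β)) f t =
      Real.Gamma (α + β) * fracInt (α + 2 * β) (fun ξ => ‖Y ξ‖ ^ 2) t := by
    obtain ⟨B', hB'⟩ := bddMeas_norm_sq hY.cont t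
    have := fracInt_fracInt hγ hβ ht.1.le hB'
    rw [← fracInt_congr ht.1.le fun s hs => hf s hs.1, fracInt_of_ne_zero hγ.ne', smul_eq_mul,
      show α + β + β = α + 2 * β by ring] at this
    rw [← this]
    have := (Real.Gamma_pos_of_pos hγ).ne'
    field_simp
  -- The upper bound for the value at t + δ, up to a constant. The powers δ^{1+α} and δ^{1+γ} have
  -- zero derivative at 0, so only the wanted terms remain.
  let g : ℝ → ℝ := fun δ => 2 * inner ℝ (Y t) (fracInt (1 - α) Y (t + δ)) +
    c1 * (H ^ 2 / (1 - α)) * δ ^ (1 + α) - c2 * μ * (∫ s in (0 : ℝ)..(t + δ), f s) +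
    c2 * μ ^ 2 * B * δ ^ (1 + (α + β)) + c2 * μ ^ 2 * posConv (abelKernel (α + β)) f t * δ
  have hg : HasDerivAt g (2 * inner ℝ (Y t) (deriv (fracInt (1 - α) Y) t) +
      c1 * (H ^ 2 / (1 - α)) * 0 - c2 * μ * f t + c2 * μ ^ 2 * B * 0 +
      c2 * μ ^ 2 * posConv (abelKernel (α + β)) f t * 1) 0 := by
    have hpow : ∀ p : ℝ, 0 < p → HasDerivAt (fun δ : ℝ => δ ^ (1 + p)) 0 0 := by
      intro p hp
      have := Real.hasDerivAt_rpow_const (x := 0) (p := 1 + p) (Or.inr (by linarith))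
      simpa [Real.zero_rpow hp.ne'] using this
    have h1 : HasDerivAt (fun δ => fracInt (1 - α) Y (t + δ)) (deriv (fracInt (1 - α) Y) t) 0 := by
      have h := hP.hasDerivAt
      rw [← add_zero t] at h
      simpa using h.comp_const_add t 0
    have h2 : HasDerivAt (fun δ => ∫ s in (0 : ℝ)..(t + δ), f s) (f t) 0 := by
      have h : HasDerivAt (fun u => ∫ s in (0 : ℝ)..u, f s) (f (t + 0)) (t + 0) :=
        integral_hasDerivAt_right (hfc.intervalIntegrable _ _)
          (hfc.stronglyMeasurableAtFilter _ _) hfc.continuousAt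
      simpa using h.comp_const_add t 0
    have h3 : HasDerivAt (fun δ => inner ℝ (Y t) (fracInt (1 - α) Y (t + δ)))
        (inner ℝ (Y t) (deriv (fracInt (1 - α) Y) t)) 0 :=
      (innerSL ℝ (Y t)).hasFDerivAt.comp_hasDerivAt 0 h1
    exact ((((h3.const_mul 2).add ((hpow α hα0).const_mul _)).sub (h2.const_mul _)).add
      ((hpow (α + β) hγ).const_mul _)).add ((hasDerivAt_id' 0).const_mul _)
  have hmain := deriv_le_of_increment_le hv hg ?_
  · refine hmain.trans (le_of_eq ?_)
    rw [hJ, hf t ht.1.le]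
    ring
  · have hnear : ∀ᶠ δ in 𝓝[>] (0 : ℝ), δ ∈ Ioo 0 (T - t) :=
      Ioo_mem_nhdsGT (sub_pos.2 ht.2)
    filter_upwards [hnear] with δ hδ
    have htδ : t + δ ≤ T := by linarith [hδ.2]
    rw [VWeighted_fracInt_eq hβ hαβ hμ hY.cont hfc hf (by linarith [ht.1, hδ.1]),
      VWeighted_fracInt_eq hβ hαβ hμ hY.cont hfc hf ht.1.le]
    have e1 := posConv_norm_sq_increment_le hα0 hα1 hY.cont.continuousOn hY.nonneg_hoelder
      hY.hoelder ht.1.le hδ.1.le htδ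
    have e2 := le_posConv_defectKernel_sub hγ hαβ hμ hfc hf0 hfB ht.1.le hδ.1.le htδ
    have e3 := inner_increment (Y := Y) hα1 t δ
    rw [← hc1d, inner_sub_right (𝕜 := ℝ) (Y t) (fracInt (1 - α) Y (t + δ))] at e3
    have e4 := mul_le_mul_of_nonneg_left e1 hc1
    have e5 := mul_le_mul_of_nonneg_left e2 hc2
    have z1 : (0 : ℝ) ^ (1 + α) = 0 := Real.zero_rpow (by linarith)
    have z2 : (0 : ℝ) ^ (1 + (α + β)) = 0 := Real.zero_rpow (by linarith)
    simp only [g, add_zero, z1, z2]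
    linarith

end Derivative

/-! ### Paths of class AC^α -/

section AC

variable {n : ℕ} {T α : ℝ}

/-- If Y = I^α ψ then I^{1-α} Y = I^1 ψ. Both bounds are thus the same Hölder estimate for bounded
ψ, at orders α and 1. -/
lemma IsAC.exists_fracLip (hT : 0 < T) (hα0 : 0 < α) (hα1 : α < 1)
    {x : C(Icc (0 : ℝ) T, E n)} (hx : IsAC hT.le α x) :
    ∃ H L, FracLip α T H L fun ξ => IccExtend hT.le x ξ - IccExtend hT.le x 0 := by
  obtain ⟨ψ, hψ, hxψ⟩ := hx
  set X := IccExtend hT.le x with hX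
  have hXc : Continuous X := x.continuous.Icc_extend'
  have hX0 : X 0 = x (zeroPt hT.le) := IccExtend_left _ _
  set M := (eLpNormEssSup ψ (volume.restrict (Icc 0 T))).toReal with hM
  have hM0 : 0 ≤ M := ENNReal.toReal_nonneg
  have hfin : eLpNormEssSup ψ (volume.restrict (Icc 0 T)) < ⊤ := by
    simpa [eLpNorm_exponent_top] using hψ.2
  have hle : volume.restrict (Ioc 0 T) ≤ volume.restrict (Icc (0 : ℝ) T) :=
    Measure.restrict_mono Ioc_subset_Icc_self le_rfl
  have hψB : BddMeas ψ T M := by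
    refine ⟨hψ.1.mono_measure hle, ae_mono hle ?_⟩
    filter_upwards [ae_le_eLpNormEssSup (f := ψ) (μ := volume.restrict (Icc 0 T))] with s hs
    have := ENNReal.toReal_mono hfin.ne hs
    simpa using this
  have hXψ : ∀ t ∈ Icc 0 T, X t - X 0 = fracInt α ψ t := by
    intro t ht
    rw [hX0, hX, IccExtend_of_mem _ _ ht, hxψ ⟨t, ht⟩]
    simp
  have hG := Real.Gamma_pos_of_pos hα0
  have key : ∀ s ∈ Icc 0 T, ∀ t ∈ Icc 0 T, s ≤ t → ‖(X t - X 0) - (X s - X 0)‖ ≤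
      (Real.Gamma α)⁻¹ * (2 * M / α) * |t - s| ^ α := by
    intro s hs t ht hst
    have h := norm_posConv_abelKernel_sub_le hα0 hα1.le hs.1 (sub_nonneg.2 hst)
      (by linarith [ht.2]) hM0 hψB
    rw [add_sub_cancel] at h
    rw [hXψ t ht, hXψ s hs, fracInt_of_ne_zero hα0.ne', fracInt_of_ne_zero hα0.ne', ← smul_sub,
      norm_smul, Real.norm_of_nonneg (inv_nonneg.2 hG.le), abs_of_nonneg (sub_nonneg.2 hst),
      mul_assoc]
    exact mul_le_mul_of_nonneg_left h (inv_nonneg.2 hG.le)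
  refine ⟨(Real.Gamma α)⁻¹ * (2 * M / α), 2 * M, ?_, ?_, by positivity, by positivity, ?_, ?_⟩
  · fun_prop
  · simp
  · intro s hs t ht
    rcases le_total s t with hst | hst
    · exact key s hs t ht hst
    · rw [norm_sub_rev, abs_sub_comm]
      exact key t ht s hs hst
  · intro t δ ht hδ htδ
    have hP : ∀ t ∈ Icc 0 T, fracInt (1 - α) (fun ξ => X ξ - X 0) t =
        posConv (abelKernel 1) ψ t := by
      intro t ht
      rw [fracInt_congr ht.1 fun s hs => hXψ s ⟨hs.1, hs.2.trans ht.2⟩,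
        fracInt_fracInt (by linarith) hα0.le ht.1 (hψB.mono ht.2), sub_add_cancel,
        fracInt_of_ne_zero one_ne_zero]
      simp
    rw [hP t ⟨ht, by linarith⟩, hP (t + δ) ⟨by linarith, htδ⟩]
    simpa using norm_posConv_abelKernel_sub_le one_pos le_rfl ht hδ htδ hM0 hψB

end AC

/-! ### Choice of the parameters -/

section Constants

/-- The bounds are conditional on positivity because the coefficients used later are known to be
positive only up to index m. -/
lemma exists_dominating_sequence (a : ℝ) (c d : ℕ → ℝ) :
    ∃ μ : ℕ → ℝ, (∀ i, 0 < μ i) ∧ (0 < c 1 → a ≤ c 1 * μ 1) ∧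
      ∀ i, 1 ≤ i → 0 < c (i + 1) → d i * μ i ^ 2 ≤ c (i + 1) * μ (i + 1) := by
  -- Shifted index: ν k is μ (k + 1). The maximum with 1 keeps every term positive.
  let ν : ℕ → ℝ := fun k => Nat.rec (max 1 (a / c 1))
    (fun k y => max 1 (d (k + 1) * y ^ 2 / c (k + 2))) k
  have hν : ∀ k, 0 < ν k := by
    intro k
    cases k <;> exact lt_of_lt_of_le one_pos (le_max_left _ _)
  refine ⟨fun i => ν (i - 1), fun i => hν _, fun h => ?_, fun i hi h => ?_⟩
  · have : a / c 1 ≤ ν 0 := le_max_right _ _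
    rw [mul_comm]
    exact (div_le_iff₀ h).1 this
  · obtain ⟨k, rfl⟩ : ∃ k, i = k + 1 := ⟨i - 1, by omega⟩
    have : d (k + 1) * ν k ^ 2 / c (k + 2) ≤ ν (k + 1) := le_max_right _ _
    rw [mul_comm (c _)]
    exact (div_le_iff₀ h).1 this

lemma sum_telescope_le {a : ℝ} {b e J : ℕ → ℝ} {m : ℕ} (hm : 1 ≤ m) (hJ : ∀ i, 0 ≤ J i)
    (h1 : a ≤ b 1) (hbe : ∀ i, 1 ≤ i → i < m → e i ≤ b (i + 1)) :
    ∑ i ∈ Finset.Icc 1 m, (-(b i * J i) + e i * J (i + 1)) ≤ -(a * J 1) + e m * J (m + 1) := by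
  induction m, hm using Nat.le_induction with
  | base =>
    have := mul_le_mul_of_nonneg_right h1 (hJ 1)
    simp only [Finset.Icc_self, Finset.sum_singleton]
    linarith
  | succ k hk ih =>
    rw [Finset.sum_Icc_succ_top (by omega)]
    have h2 := ih fun i hi hik => hbe i hi (by omega)
    have h3 := mul_le_mul_of_nonneg_right (hbe k hk (by omega)) (hJ (k + 1))
    linarith

/-- The exponents `β_i = (2^{i-1} - 1) α`. -/
noncomputable def expo (α : ℝ) (i : ℕ) : ℝ := ((2 : ℝ) ^ (i - 1) - 1) * α

variable {α : ℝ} {i m : ℕ}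

lemma expo_one : expo α 1 = 0 := by simp [expo]

lemma expo_nonneg (hα : 0 ≤ α) : 0 ≤ expo α i :=
  mul_nonneg (sub_nonneg.2 (one_le_pow₀ one_le_two)) hα

/-- This recursion links consecutive functionals: the order of the bad term at i is that of the good
term at i + 1. -/
lemma expo_succ (hi : 1 ≤ i) : expo α (i + 1) = α + 2 * expo α i := by
  obtain ⟨k, rfl⟩ : ∃ k, i = k + 1 := ⟨i - 1, by omega⟩
  simp only [expo, Nat.add_sub_cancel]
  ring

lemma add_expo_lt_one (hα : 0 ≤ α) (hm : α < (1 / 2 : ℝ) ^ (m - 1)) (him : i ≤ m) :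
    α + expo α i < 1 := by
  have h1 : (2 : ℝ) ^ (i - 1) ≤ 2 ^ (m - 1) := pow_le_pow_right₀ one_le_two (by omega)
  have h2 : (2 : ℝ) ^ (m - 1) * α < 1 := by
    rw [one_div, inv_pow] at hm
    have := mul_lt_mul_of_pos_left hm (by positivity : (0 : ℝ) < 2 ^ (m - 1))
    rwa [mul_inv_cancel₀ (by positivity)] at this
  unfold expo
  nlinarith

/-- Since α + β_{m+1} = 2^m α ≥ 1, the chain may stop after m steps. -/
lemma one_sub_le_expo_succ (hm : (1 / 2 : ℝ) ^ m ≤ α) : 1 - α ≤ expo α (m + 1) := by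
  rw [one_div, inv_pow] at hm
  have := mul_le_mul_of_nonneg_left hm (by positivity : (0 : ℝ) ≤ 2 ^ m)
  rw [mul_inv_cancel₀ (by positivity)] at this
  simp only [expo, Nat.add_sub_cancel]
  linarith

lemma exists_dyadic (hα0 : 0 < α) (hα1 : α < 1) :
    ∃ m : ℕ, 1 ≤ m ∧ (1 / 2 : ℝ) ^ m ≤ α ∧ α < (1 / 2 : ℝ) ^ (m - 1) := by
  classical
  have hex : ∃ m : ℕ, (1 / 2 : ℝ) ^ m ≤ α := by
    obtain ⟨m, hm⟩ := exists_pow_lt_of_lt_one hα0 (by norm_num : (1 / 2 : ℝ) < 1)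
    exact ⟨m, hm.le⟩
  have h1 : 1 ≤ Nat.find hex := by
    rw [Nat.one_le_iff_ne_zero, Ne, Nat.find_eq_zero]
    simpa using hα1
  exact ⟨Nat.find hex, h1, Nat.find_spec hex, not_le.1 (Nat.find_min hex (by omega))⟩

/-- The last fractional integral of the chain is dominated by the last weighted functional. -/
lemma exists_absorbing_constant {T β μ b : ℝ} (hα0 : 0 < α) (hβ : 0 ≤ β) (hαβ : α + β < 1)
    (hμ : 0 < μ) (hT : 0 < T) (hb : 1 - α ≤ b) :
    ∃ κ, 0 < κ ∧ ∀ {F : Type} [NormedAddCommGroup F] (Y : ℝ → F), Continuous Y →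
      ∀ t ∈ Icc 0 T, κ * fracInt b (fun ξ => ‖Y ξ‖ ^ 2) t ≤
        VWeighted (α + β) μ t (fracInt β fun ξ => ‖Y ξ‖ ^ 2) := by
  have ha : 0 < 1 - α := by linarith
  have hG1 := Real.Gamma_pos_of_pos ha
  have hG2 := Real.Gamma_pos_of_pos (ha.trans_le hb)
  set A := T ^ (b - (1 - α)) * Real.Gamma (1 - α) / Real.Gamma b with hA
  have hA0 : 0 < A := by positivity
  refine ⟨Real.exp (-μ * T ^ (α + β)) / A, by positivity, fun {F} _ Y hY t ht => ?_⟩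
  obtain ⟨B', hB'⟩ := bddMeas_norm_sq hY t
  obtain ⟨f, hfc, hf⟩ := exists_continuous_eq_fracInt hβ hY
  obtain ⟨B, hB⟩ := isCompact_Icc.exists_bound_of_continuousOn (hfc.continuousOn (s := Icc 0 t))
  have h1 := fracInt_le_mul_fracInt ha hb ht.1 ht.2 hB' fun s _ => by positivity
  have h2 := exp_mul_fracInt_le_VWeighted (γ := α + β) (by linarith) hαβ hμ.le ht.1 ht.2
    (BddMeas.of_continuousOn hfc.continuousOn hB) fun s hs => by
      rw [hf s hs.1]; exact fracInt_nonneg hβ hs.1 fun _ _ => by positivity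
  rw [fracInt_congr ht.1 fun s hs => hf s hs.1, fracInt_fracInt (by linarith) hβ ht.1 hB',
    show 1 - (α + β) + β = 1 - α by ring, VWeighted_congr ht.1 fun s hs => hf s hs.1] at h2
  refine le_trans ?_ h2
  rw [div_mul_eq_mul_div, div_le_iff₀ hA0, mul_assoc]
  refine mul_le_mul_of_nonneg_left ?_ (Real.exp_nonneg _)
  rw [mul_comm _ A]
  exact h1

end Constants

/-! ### Restricted paths and compactness -/

section Paths

variable {n : ℕ} {T : ℝ}

lemma restr_ext (hT : 0 ≤ T) (x : C(Icc (0 : ℝ) T, E n)) (t : Icc (0 : ℝ) T) {s : ℝ}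
    (hs : s ∈ Icc 0 (t : ℝ)) : (restr x t).ext s = IccExtend hT x s := by
  rw [(restr x t).ext_of_mem hs, IccExtend_of_mem _ _ ⟨hs.1, hs.2.trans t.2.2⟩]
  rfl

lemma VStar_restr (hT : 0 ≤ T) {α β μ : ℝ} (x : C(Icc (0 : ℝ) T, E n)) (t : Icc (0 : ℝ) T) :
    VStar α β μ (restr x t) = VWeighted (α + β) μ t
      (fracInt β fun ξ => ‖IccExtend hT x ξ - IccExtend hT x 0‖ ^ 2) := by
  refine VWeighted_congr t.2.1 fun s hs => fracInt_congr hs.1 fun ξ hξ => ?_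
  rw [← G.ext_zero, restr_ext hT x t ⟨hξ.1, hξ.2.trans hs.2⟩, restr_ext hT x t ⟨le_rfl, t.2.1⟩]

lemma VStar_nonneg {α β μ : ℝ} (hβ : 0 ≤ β) (hαβ : α + β < 1) (p : G n T) :
    0 ≤ VStar α β μ p :=
  VWeighted_nonneg hαβ p.time_nonneg fun s hs =>
    fracInt_nonneg hβ hs.1 fun _ _ => by positivity

lemma VStar_eq_zero_of_const {α β μ : ℝ} (p : G n T) (hp : ∀ τ, p.path τ = p.init) :
    VStar α β μ p = 0 := by
  rw [VStar, VWeighted_congr (g := fun _ => 0) p.time_nonneg fun s hs => fracInt_eq_zero hs.1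
    fun ξ _ => by rw [G.ext_eq, hp]; simp]
  simp [VWeighted]

/-- Equal domains allow each time to be matched with itself. -/
lemma dist_restr_le (x y : C(Icc (0 : ℝ) T, E n)) (t : Icc (0 : ℝ) T) :
    dist (restr x t) (restr y t) ≤ dist x y := by
  have key : ∀ x y : C(Icc (0 : ℝ) T, E n), ∀ τ, ∃ τ',
      G.ptDist (restr x t) (restr y t) τ τ' ≤ dist x y := by
    intro x y τ
    refine ⟨τ, ?_⟩
    unfold G.ptDist
    rw [sub_self, abs_zero, zero_pow two_ne_zero, zero_add, Real.sqrt_sq (norm_nonneg _),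
      ← dist_eq_norm]
    exact ContinuousMap.dist_apply_le_dist (f := x) (g := y) _
  rw [G.dist_le_iff]
  refine ⟨key x y, ?_⟩
  rw [dist_comm]
  exact key y x

lemma continuous_restr (t : Icc (0 : ℝ) T) :
    Continuous fun x : C(Icc (0 : ℝ) T, E n) => restr x t :=
  (LipschitzWith.of_dist_le_mul (K := 1) fun x y => by
    simpa using dist_restr_le x y t).continuous

/-- A continuous nonnegative functional that vanishes only on constant paths controls, on compact
sets, the distance to the constant paths. -/
lemma exists_delta_of_isCompact {T : ℝ} (hT : 0 ≤ T) {V : C(Icc (0 : ℝ) T, E n) → ℝ}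
    (hV : Continuous V) (hV0 : ∀ x, 0 ≤ V x)
    (hzero : ∀ x, V x = 0 → x = ContinuousMap.const _ (x (zeroPt hT)))
    {K : Set C(Icc (0 : ℝ) T, E n)} (hK : IsCompact K) {ρ : ℝ} (hρ : 0 < ρ) :
    ∃ δ : ℝ, 0 < δ ∧ ∀ x ∈ K, V x ≤ δ → ‖x - ContinuousMap.const _ (x (zeroPt hT))‖ ≤ ρ := by
  have hc : Continuous fun x : C(Icc (0 : ℝ) T, E n) =>
      ‖x - ContinuousMap.const _ (x (zeroPt hT))‖ := by
    have h1 : Continuous fun x : C(Icc (0 : ℝ) T, E n) => x (zeroPt hT) :=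
      continuous_eval_const _
    have h2 : Continuous fun x : C(Icc (0 : ℝ) T, E n) =>
        ContinuousMap.const (Icc (0 : ℝ) T) (x (zeroPt hT)) := ContinuousMap.continuous_const'.comp h1
    exact (continuous_id.sub h2).norm
  have hS : IsCompact (K ∩ {x | ρ ≤ ‖x - ContinuousMap.const _ (x (zeroPt hT))‖}) :=
    hK.inter_right (isClosed_le continuous_const hc)
  rcases (K ∩ {x | ρ ≤ ‖x - ContinuousMap.const _ (x (zeroPt hT))‖}).eq_empty_or_nonempty
    with he | hne
  · refine ⟨1, one_pos, fun x hx _ => ?_⟩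
    by_contra hcon
    exact (he ▸ (⟨hx, (not_le.1 hcon).le⟩ : x ∈ K ∩ _) : x ∈ (∅ : Set _))
  · obtain ⟨y, hy, hmin⟩ := hS.exists_isMinOn hne hV.continuousOn
    have hpos : 0 < V y := by
      refine lt_of_le_of_ne (hV0 y) fun h0 => ?_
      have h1 := hzero y h0.symm
      have h2 : ρ ≤ ‖y - ContinuousMap.const _ (y (zeroPt hT))‖ := hy.2
      rw [← h1, sub_self, norm_zero] at h2
      linarith
    refine ⟨V y / 2, by positivity, fun x hx hxV => ?_⟩
    by_contra hcon
    have : V y ≤ V x := hmin ⟨hx, (not_le.1 hcon).le⟩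
    linarith

lemma eq_const_of_VStar_eq_zero (hT : 0 < T) {α μ : ℝ} (hα1 : α < 1) (hμ : 0 ≤ μ)
    (x : C(Icc (0 : ℝ) T, E n)) (h : VStar α 0 μ (restr x ⟨T, hT.le, le_rfl⟩) = 0) :
    x = ContinuousMap.const _ (x (zeroPt hT.le)) := by
  rw [VStar_restr hT.le, fracInt_zero, add_zero] at h
  have hc : Continuous (IccExtend hT.le x) := x.continuous.Icc_extend'
  have h0 := eq_zero_of_VWeighted_eq_zero hα1 hμ hT (by fun_prop) (fun s _ => by positivity) h
  ext1 τ
  have := h0 τ τ.2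
  rw [sq_eq_zero_iff, norm_eq_zero, sub_eq_zero, IccExtend_val] at this
  rw [this, ContinuousMap.const_apply]
  exact IccExtend_left _ _

end Paths

/-! ### The damped sum of functionals -/

section Total

/-- The increments of a damped sum of functions with Lipschitz increments. -/
lemma exists_increment_damped_sum_le {ι : Type*} (s : Finset ι) {w : ι → ℝ → ℝ} {T l c : ℝ}
    (hT : 0 ≤ T) (hl : 0 ≤ l) (hc : 0 ≤ c)
    (hw : ∀ i ∈ s, ∃ C, 0 ≤ C ∧ ∀ t δ, 0 ≤ t → 0 ≤ δ → t + δ ≤ T → |w i (t + δ) - w i t| ≤ C * δ) :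
    ∃ C, 0 ≤ C ∧ ∀ t δ, 0 ≤ t → 0 ≤ δ → t + δ ≤ T →
      ‖Real.exp (-l * (t + δ)) / c * ∑ i ∈ s, w i (t + δ) -
        Real.exp (-l * t) / c * ∑ i ∈ s, w i t‖ ≤ C * δ := by
  choose! C hC0 hC using hw
  set D := ∑ i ∈ s, C i with hD
  have hD0 : 0 ≤ D := Finset.sum_nonneg hC0
  have hS : ∀ t δ, 0 ≤ t → 0 ≤ δ → t + δ ≤ T →
      |∑ i ∈ s, w i (t + δ) - ∑ i ∈ s, w i t| ≤ D * δ := by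
    intro t δ ht hδ htδ
    rw [← Finset.sum_sub_distrib, hD, Finset.sum_mul]
    exact (Finset.abs_sum_le_sum_abs _ _).trans
      (Finset.sum_le_sum fun i hi => hC i hi t δ ht hδ htδ)
  set S0 := |∑ i ∈ s, w i 0| + D * T with hS0
  have hS00 : 0 ≤ S0 := by positivity
  have hbd : ∀ t ∈ Icc 0 T, |∑ i ∈ s, w i t| ≤ S0 := by
    intro t ht
    have h1 := hS 0 t le_rfl ht.1 (by linarith [ht.2])
    rw [zero_add] at h1
    have h2 := abs_sub_abs_le_abs_sub (∑ i ∈ s, w i t) (∑ i ∈ s, w i 0)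
    have h3 : D * t ≤ D * T := mul_le_mul_of_nonneg_left ht.2 hD0
    linarith
  refine ⟨(D + l * S0) / c, by positivity, fun t δ ht hδ htδ => ?_⟩
  have e1 : Real.exp (-l * (t + δ)) ≤ 1 := Real.exp_le_one_iff.2 (by nlinarith)
  have e2 : |Real.exp (-l * (t + δ)) - Real.exp (-l * t)| ≤ l * δ := by
    have h1 : Real.exp (-l * (t + δ)) = Real.exp (-l * t) * Real.exp (-(l * δ)) := by
      rw [← Real.exp_add]
      congr 1
      ring
    have h2 := Real.add_one_le_exp (-(l * δ))
    have h3 : Real.exp (-l * t) ≤ 1 := Real.exp_le_one_iff.2 (by nlinarith)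
    have h4 : Real.exp (-(l * δ)) ≤ 1 := Real.exp_le_one_iff.2 (by nlinarith)
    have h5 := Real.exp_pos (-l * t)
    rw [h1, abs_sub_comm, abs_of_nonneg (by nlinarith)]
    nlinarith
  have e3 : Real.exp (-l * (t + δ)) / c * ∑ i ∈ s, w i (t + δ) -
      Real.exp (-l * t) / c * ∑ i ∈ s, w i t =
      (Real.exp (-l * (t + δ)) * (∑ i ∈ s, w i (t + δ) - ∑ i ∈ s, w i t) +
        (Real.exp (-l * (t + δ)) - Real.exp (-l * t)) * ∑ i ∈ s, w i t) / c := by ring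
  rw [e3, Real.norm_eq_abs, abs_div, abs_of_nonneg hc, div_mul_eq_mul_div]
  gcongr
  refine (abs_add_le _ _).trans ?_
  rw [abs_mul, abs_mul, abs_of_pos (Real.exp_pos _)]
  calc _ ≤ 1 * (D * δ) + (l * δ) * S0 :=
        add_le_add (mul_le_mul e1 (hS t δ ht hδ htδ) (abs_nonneg _) zero_le_one)
          (mul_le_mul e2 (hbd t ⟨ht, by linarith⟩) (abs_nonneg _) (by positivity))
    _ = _ := by ring

/-- Rademacher's theorem; dropping the two endpoints makes the derivative two-sided. -/
lemma ae_differentiableAt_of_increment_le {F : Type*} [NormedAddCommGroup F] [NormedSpace ℝ F]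
    [FiniteDimensional ℝ F] {g : ℝ → F} {T L : ℝ} (hL : 0 ≤ L)
    (h : ∀ t δ, 0 ≤ t → 0 ≤ δ → t + δ ≤ T → ‖g (t + δ) - g t‖ ≤ L * δ) :
    ∀ᵐ t ∂(volume.restrict (Icc 0 T)), t ∈ Ioo 0 T ∧ DifferentiableAt ℝ g t := by
  have h1 := (lipschitzOnWith_of_increment_le hL h).ae_differentiableWithinAt_of_mem
    (μ := volume)
  rw [← restrict_Ioo_eq_restrict_Icc]
  filter_upwards [ae_restrict_of_ae h1, ae_restrict_mem measurableSet_Ioo] with t ht htm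
  exact ⟨htm, (ht ⟨htm.1.le, htm.2.le⟩).differentiableAt (Icc_mem_nhds htm.1 htm.2)⟩

lemma deriv_damped_sum {ι : Type*} (s : Finset ι) {w : ι → ℝ → ℝ} {t l c : ℝ}
    (hw : ∀ i ∈ s, DifferentiableAt ℝ (w i) t) :
    HasDerivAt (fun t => Real.exp (-l * t) / c * ∑ i ∈ s, w i t)
      (Real.exp (-l * t) / c * (∑ i ∈ s, deriv (w i) t - l * ∑ i ∈ s, w i t)) t := by
  have h1 : HasDerivAt (fun t => Real.exp (-l * t) / c) (-l * Real.exp (-l * t) / c) t := by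
    have := ((hasDerivAt_id' t).const_mul (-l)).exp.div_const c
    convert! this using 1
    ring
  have h2 : HasDerivAt (fun t => ∑ i ∈ s, w i t) (∑ i ∈ s, deriv (w i) t) t :=
    HasDerivAt.fun_sum fun i hi => (hw i hi).hasDerivAt
  convert! h1.mul h2 using 1
  ring

end Total

end FracHJ

/-! ### Assembly of the functional -/

theorem mainTheorem6 (n : ℕ) (T : ℝ) (hT : 0 < T) (α : ℝ) (hα0 : 0 < α) (hα1 : α < 1)
    (lam : ℝ) (hlam : 0 < lam) :
    ∃ (lamStar : ℝ) (V : FracHJ.G n T → ℝ), 0 < lamStar ∧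
      -- nonnegativity, continuity, vanishing on constant paths
      ((∀ p, 0 ≤ V p) ∧ Continuous V ∧
        ∀ p : FracHJ.G n T, (∀ τ, p.path τ = p.init) → V p = 0) ∧
      -- the differential inequality along paths of class AC^α
      (∀ x : C(Set.Icc (0 : ℝ) T, FracHJ.E n), FracHJ.IsAC hT.le α x →
        let X : ℝ → FracHJ.E n := Set.IccExtend hT.le x
        let v : ℝ → ℝ := Set.IccExtend hT.le fun t => V (FracHJ.restr x t)
        (∃ K, LipschitzOnWith K v (Set.Icc 0 T)) ∧
          ∀ᵐ t ∂(MeasureTheory.volume.restrict (Set.Icc 0 T)),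
            DifferentiableAt ℝ v t ∧
            DifferentiableAt ℝ (FracHJ.caputoPrimitive α X) t ∧
            deriv v t ≤ Real.exp (-lamStar * t) *
              (2 * inner ℝ (X t - X 0) (FracHJ.caputoDeriv α X t) - lam * ‖X t - X 0‖ ^ 2)) ∧
      -- smallness of V(T, x) forces smallness of x - x(0), uniformly on compact sets
      (∀ K : Set C(Set.Icc (0 : ℝ) T, FracHJ.E n), IsCompact K → ∀ ρ : ℝ, 0 < ρ →
        ∃ δ : ℝ, 0 < δ ∧ ∀ x ∈ K, V (FracHJ.restr x ⟨T, hT.le, le_rfl⟩) ≤ δ →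
          ‖x - ContinuousMap.const _ (x (FracHJ.zeroPt hT.le))‖ ≤ ρ) ∧
      -- the form of the functional
      (∃ (m : ℕ) (μ : ℕ → ℝ), 1 ≤ m ∧ (1 / 2 : ℝ) ^ m ≤ α ∧ α < (1 / 2 : ℝ) ^ (m - 1) ∧
        (∀ i ∈ Finset.Icc 1 m, 0 < μ i) ∧
        ∀ p : FracHJ.G n T, V p = Real.exp (-lamStar * (p.time : ℝ)) / m *
          ∑ i ∈ Finset.Icc 1 m, FracHJ.VStar α (((2 : ℝ) ^ (i - 1) - 1) * α) (μ i) p) := by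
  open FracHJ in
  obtain ⟨m, hm1, hmα, hαm⟩ := exists_dyadic hα0 hα1
  have hlt : ∀ i ∈ Finset.Icc 1 m, α + expo α i < 1 := fun i hi =>
    add_expo_lt_one hα0.le hαm (Finset.mem_Icc.1 hi).2
  have hβ : ∀ i, 0 ≤ expo α i := fun i => expo_nonneg hα0.le
  let c : ℕ → ℝ := fun i => (Real.Gamma (1 - (α + expo α i)))⁻¹
  let d : ℕ → ℝ := fun i => c i * Real.Gamma (α + expo α i)
  have hcpos : ∀ i, 1 ≤ i → i ≤ m → 0 < c i := fun i h1 h2 =>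
    inv_pos.2 (Real.Gamma_pos_of_pos (by linarith [hlt i (Finset.mem_Icc.2 ⟨h1, h2⟩)]))
  -- The target m λ offsets the division of the sum by m.
  obtain ⟨μ, hμ, hμ1, hμs⟩ := exists_dominating_sequence (m * lam) c d
  have hmm : m ∈ Finset.Icc 1 m := Finset.mem_Icc.2 ⟨hm1, le_rfl⟩
  have h1m : 1 ∈ Finset.Icc 1 m := Finset.mem_Icc.2 ⟨le_rfl, hm1⟩
  have hm0 : (0 : ℝ) < m := by exact_mod_cast hm1
  obtain ⟨κ, hκ, hκV⟩ := exists_absorbing_constant (b := expo α (m + 1)) hα0 (hβ m) (hlt m hmm)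
    (hμ m) hT (one_sub_le_expo_succ hmα)
  have hdm : 0 < d m := mul_pos (hcpos m hm1 le_rfl)
    (Real.Gamma_pos_of_pos (by linarith [hβ m]))
  -- Chosen so that l times the last functional dominates the unmatched term d_m μ_m²
  -- I^{β_{m+1}}‖Y‖².
  set l := d m * μ m ^ 2 / κ with hl
  have hl0 : 0 < l := by have := hμ m; positivity
  let V : G n T → ℝ := fun p => Real.exp (-l * (p.time : ℝ)) / m *
    ∑ i ∈ Finset.Icc 1 m, VStar α (expo α i) (μ i) p
  have hVc : Continuous V := by
    refine Continuous.mul ?_ (continuous_finsetSum _ fun i hi =>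
      continuous_VStar (hβ i) (hlt i hi) (hμ i).le)
    exact ((Real.continuous_exp.comp (continuous_const.mul G.continuous_time)).div_const _)
  have hV0 : ∀ p, 0 ≤ V p := fun p => mul_nonneg (by positivity)
    (Finset.sum_nonneg fun i hi => VStar_nonneg (hβ i) (hlt i hi) p)
  refine ⟨l, V, hl0, ⟨hV0, hVc, fun p hp => ?_⟩, fun x hx => ?_, fun K hK ρ hρ => ?_,
    m, μ, hm1, hmα, hαm, fun i _ => hμ i, fun p => rfl⟩
  · simp only [V, VStar_eq_zero_of_const p hp, Finset.sum_const_zero, mul_zero]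
  · intro X v
    obtain ⟨H, L, hY⟩ := hx.exists_fracLip hT hα0 hα1
    let Y : ℝ → E n := fun ξ => X ξ - X 0
    change FracLip α T H L Y at hY
    let w : ℕ → ℝ → ℝ := fun i t =>
      VWeighted (α + expo α i) (μ i) t (fracInt (expo α i) fun ξ => ‖Y ξ‖ ^ 2)
    let u : ℝ → ℝ := fun t => Real.exp (-l * t) / m * ∑ i ∈ Finset.Icc 1 m, w i t
    have hvu : ∀ t ∈ Set.Icc 0 T, v t = u t := by
      intro t ht
      simp only [v, u, Set.IccExtend_of_mem hT.le _ ht, V]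
      congr 1
      exact Finset.sum_congr rfl fun i _ => VStar_restr hT.le x ⟨t, ht⟩
    have hw := fun i (hi : i ∈ Finset.Icc 1 m) =>
      hY.exists_increment_le hα0 (hβ i) (hlt i hi) (hμ i) hT.le
    obtain ⟨C, hC0, hC⟩ := exists_increment_damped_sum_le (Finset.Icc 1 m) (w := w) (c := m)
      hT.le hl0.le hm0.le hw
    refine ⟨⟨C.toNNReal, ?_⟩, ?_⟩
    · intro s hs t ht
      rw [hvu s hs, hvu t ht]
      exact lipschitzOnWith_of_increment_le hC0 hC hs ht
    · have hdw : ∀ᵐ t ∂(MeasureTheory.volume.restrict (Set.Icc 0 T)), ∀ i ∈ Finset.Icc 1 m,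
          DifferentiableAt ℝ (w i) t := by
        rw [Filter.eventually_all_finset]
        intro i hi
        obtain ⟨Ci, hCi0, hCi⟩ := hw i hi
        filter_upwards [ae_differentiableAt_of_increment_le (g := w i) hCi0 hCi] with t ht using ht.2
      have hdP := ae_differentiableAt_of_increment_le hY.nonneg_lip hY.lip
      filter_upwards [hdw, hdP] with t htw htP
      obtain ⟨htm, htP⟩ := htP
      have hvu' : v =ᶠ[nhds t] u := by
        filter_upwards [Icc_mem_nhds htm.1 htm.2] with s hs using hvu s hs
      have hu := (deriv_damped_sum (Finset.Icc 1 m) (l := l) (c := m) htw).congr_of_eventuallyEq hvu'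
      refine ⟨hu.differentiableAt, htP, ?_⟩
      rw [hu.deriv]
      set J : ℕ → ℝ := fun i => fracInt (expo α i) (fun ξ => ‖Y ξ‖ ^ 2) t with hJ
      have hJ0 : ∀ i, 0 ≤ J i := fun i => fracInt_nonneg (hβ i) htm.1.le fun _ _ => by positivity
      set Q := 2 * inner ℝ (Y t) (deriv (fracInt (1 - α) Y) t) with hQ
      have h1 : ∑ i ∈ Finset.Icc 1 m, deriv (w i) t ≤ ∑ i ∈ Finset.Icc 1 m,
          (Q + (-((c i * μ i) * J i) + (d i * μ i ^ 2) * J (i + 1))) := by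
        refine Finset.sum_le_sum fun i hi => ?_
        have := hY.deriv_VWeighted_le hα0 (hβ i) (hlt i hi) (hμ i) htm (htw i hi) htP
        rw [← expo_succ (Finset.mem_Icc.1 hi).1] at this
        refine this.trans (le_of_eq ?_)
        simp only [J, d, c, Q]
        ring
      have h2 := sum_telescope_le (a := m * lam) (b := fun i => c i * μ i)
        (e := fun i => d i * μ i ^ 2) hm1 hJ0 (hμ1 (hcpos 1 le_rfl hm1))
        fun i hi him => hμs i hi (hcpos (i + 1) (by omega) him)
      have h3 : d m * μ m ^ 2 * J (m + 1) ≤ l * ∑ i ∈ Finset.Icc 1 m, w i t := by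
        have h4 : w m t ≤ ∑ i ∈ Finset.Icc 1 m, w i t :=
          Finset.single_le_sum (f := fun i => w i t) (fun i hi => VWeighted_nonneg (hlt i hi)
            htm.1.le fun s hs => fracInt_nonneg (hβ i) hs.1 fun _ _ => by positivity) hmm
        have h5 := (hκV Y hY.cont t ⟨htm.1.le, htm.2.le⟩).trans h4
        calc d m * μ m ^ 2 * J (m + 1) = l * (κ * J (m + 1)) := by
              rw [hl]; field_simp
          _ ≤ _ := mul_le_mul_of_nonneg_left h5 hl0.le
      have h6 : J 1 = ‖Y t‖ ^ 2 := by simp only [hJ, expo_one, fracInt_zero]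
      rw [Finset.sum_add_distrib, Finset.sum_const, Nat.card_Icc, nsmul_eq_mul,
        Nat.add_sub_cancel] at h1
      rw [h6] at h2
      have h7 : ∑ i ∈ Finset.Icc 1 m, deriv (w i) t - l * ∑ i ∈ Finset.Icc 1 m, w i t ≤
          m * (Q - lam * ‖Y t‖ ^ 2) := by linarith
      calc _ ≤ Real.exp (-l * t) / m * (m * (Q - lam * ‖Y t‖ ^ 2)) := by gcongr
        _ = Real.exp (-l * t) * (Q - lam * ‖Y t‖ ^ 2) := by field_simp
  · refine exists_delta_of_isCompact hT.le (V := fun x => V (restr x ⟨T, hT.le, le_rfl⟩))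
      (hVc.comp (continuous_restr _)) (fun x => hV0 _) (fun x hx0 => ?_) hK hρ
    have h1 : (0 : ℝ) < Real.exp (-l * T) / m := by positivity
    have h2 := (mul_eq_zero.1 hx0).resolve_left h1.ne'
    -- Nonnegative summands all vanish; the first, with β_1 = 0, already forces the path to be
    -- constant.
    rw [Finset.sum_eq_zero_iff_of_nonneg fun i hi => VStar_nonneg (hβ i) (hlt i hi) _] at h2
    have h3 := h2 1 h1m
    rw [expo_one] at h3
    exact eq_const_of_VStar_eq_zero hT hα1 (hμ 1).le x h3
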